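/- Let $S$ and $T$ be standard Borel spaces and let $\rho:S\times T\to[0,\infty)$ be measurable (not necessarily bounded). For $x_1^n=(x_1,\dots,x_n)\in S^n$ and $D\in\mathbb{R}$ put $$B_n(x_1^n,D)=\Bigl\{y_1^n\in T^n:\ \tfrac1n\sum_{k=1}^n\rho(x_k,y_k)\le D\Bigr\},$$ and let $P_{x_1^n}=\frac1n\sum_{k=1}^n\delta_{x_k}$ be the empirical distribution of $x_1^n$. For probability measures $P$ on $S$ and $Q$ on $T$ let $Q^n$ be the $n$-fold product measure of $Q$ on $T^n$, put $$L_n(x_1^n,Q^n,D)=-\frac1n\log Q^n\bigl(B_n(x_1^n,D)\bigr)\in[0,\infty]$$ (natural logarithm, $\log 0=-\infty$), and define $$R(P,Q,D)=\inf_W H(W\,\|\,P\times Q)\in[0,\infty],$$ where $H$ denotes relative entropy in nats and the infimum is over all probability measures $W$ on $S\times T$ with first marginal $P$ and $\int\rho\,dW\le D$ (the infimum over the empty set is $+\infty$). Theorem. Let $(X_n)_{n\ge1}$ be a stationary and ergodic sequence of random variables with values in $S$, with $X_1\sim P$, and let $Q$ be a probability measure on $T$. Then for every $D\in\mathbb{R}$,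 almost surely, $$\liminf_{n\to\infty}L_n(X_1^n,Q^n,D)=R(P,Q,D),$$ and likewise, almost surely, $$\liminf_{n\to\infty}R(P_{X_1^n},Q,D)=R(P,Q,D).$$ -/

import Mathlib

open MeasureTheory Filter
open scoped ENNReal NNReal

namespace GenAEP

variable {S T Ω : Type*} [MeasurableSpace S] [MeasurableSpace T] [MeasurableSpace Ω]

/-- The process `X 0, X 1, X 2, …` of measurable maps on `(Ω, μ)` is stationary and ergodic: the
left shift on the sequence space `ℕ → S` preserves the law of the process, and every measurable
shift-invariant set has probability zero or one under that law. -/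
def IsStationaryErgodic (X : ℕ → Ω → S) (μ : Measure Ω) : Prop :=
  (∀ k, Measurable (X k)) ∧
    Ergodic (fun (x : ℕ → S) (k : ℕ) => x (k + 1)) (μ.map fun ω k => X k ω)

/-- The per-letter distortion `ρₙ(x, y) = (1 / n) ∑ₖ ρ(xₖ, yₖ)` of two strings of length `n`. -/
noncomputable def distortion (ρ : S × T → ℝ≥0) {n : ℕ} (x : Fin n → S) (y : Fin n → T) : ℝ :=
  (1 / (n : ℝ)) * ∑ k, (ρ (x k, y k) : ℝ)

/-- The distortion ball `Bₙ(x, D)`. -/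
def distortionBall (ρ : S × T → ℝ≥0) {n : ℕ} (x : Fin n → S) (D : ℝ) : Set (Fin n → T) :=
  {y | distortion ρ x y ≤ D}

/-- `Lₙ(x, Qₙ, D) = -(1 / n) log Qₙ(Bₙ(x, D))`, with `log 0 = -∞`, so that the value is `+∞` if
the ball has probability zero (`n ≥ 1`). -/
noncomputable def matchingRate (ρ : S × T → ℝ≥0) {n : ℕ} (x : Fin n → S)
    (Qn : Measure (Fin n → T)) (D : ℝ) : EReal :=
  ((-(1 / (n : ℝ)) : ℝ) : EReal) * ENNReal.log (Qn (distortionBall ρ x D))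

/-- `W(P, D)`: the probability measures on `S × T` whose first marginal is `P` and whose expected
distortion is at most `D`. -/
def couplings (ρ : S × T → ℝ≥0) (P : Measure S) (D : ℝ) : Set (Measure (S × T)) :=
  {W | IsProbabilityMeasure W ∧ W.fst = P ∧
    ((∫⁻ z, (ρ z : ℝ≥0∞) ∂W : ℝ≥0∞) : EReal) ≤ (D : EReal)}

/-- The rate function `R(P, Q, D) = inf { H(W ‖ P × Q) : W ∈ W(P, D) }` in nats, which is `+∞` if
`W(P, D)` is empty. -/
noncomputable def rate (ρ : S × T → ℝ≥0) (P : Measure S) (Q : Measure T) (D : ℝ) : ℝ≥0∞ :=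
  ⨅ W ∈ couplings ρ P D, InformationTheory.klDiv W (P.prod Q)

/-- The empirical distribution `(1 / n) ∑ₖ δ_{xₖ}` of a string of length `n ≥ 1`. -/
noncomputable def empiricalMeasure {n : ℕ} (x : Fin n → S) : Measure S :=
  (n : ℝ≥0∞)⁻¹ • ∑ k, Measure.dirac (x k)

end GenAEP

/-! Write Λ_t(x) = -log ∫ exp(-t ρ(x,y)) dQ(y) (`letterCumulant`). Both sequences are compared with
the dual functional t ↦ ∫ Λ_t dP - tD on t ≥ 0; `DualBound` at c says that it never exceeds c. The
Gibbs inequality gives `dualBound_of_rate_lt`, strong duality gives `rate_le_of_dualBound`, so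
R(P,Q,D) is the threshold of c at which `DualBound` starts to hold.

If `DualBound` fails at c, then for some t the ergodic averages of Λ_t eventually exceed c + tD. The
Chernoff bound for the ball, and weak duality for the empirical measure, then keep both rates at
least c (`ae_eventually_ge_of_not_dualBound`).

If `DualBound` holds at c, both rates must be at most c + ε infinitely often
(`ae_frequently_le_of_dualBound`). The derivative of Λ_t in t is the mean of ρ(x,·) under the tilted
law exp(-tρ) dQ. When some tilt has P-averaged mean below D, a nearly optimal one does too
(`exists_tilt`). The tilted product law then charges the ball with most of its mass, and the bounds
hold for all large n.

Otherwise D is exactly the P-mean of the essential minimum of ρ(x,·), and the optimal coupling lives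
on the set where the minimum is attained (`integral_letterMin_of_le_letterMean`). In this boundary
case the empirical average of the minima fluctuates around D and the bounds are usable only when it
is at most D. This is why a lower limit appears. That it happens infinitely often is a recurrence
statement, `ae_frequently_birkhoffSum_nonpos`: centred Birkhoff sums of an ergodic system are
infinitely often nonpositive. -/

namespace GenAEP

/-! ### Pointwise ergodic theorem and recurrence of centred Birkhoff sums -/

section Ergodic

variable {α : Type*} {τ : α → α} {f : α → ℝ}

/-- The running maximum of the Birkhoff sums `S₀, …, Sₙ` of `f`. -/
noncomputable def maxBirkhoff (τ : α → α) (f : α → ℝ) : ℕ → α → ℝ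
  | 0, _ => 0
  | n + 1, x => max 0 (f x + maxBirkhoff τ f n (τ x))

lemma maxBirkhoff_nonneg (n : ℕ) (x : α) : 0 ≤ maxBirkhoff τ f n x := by
  cases n with
  | zero => exact le_rfl
  | succ n => exact le_max_left _ _

lemma maxBirkhoff_le_succ (n : ℕ) : ∀ x, maxBirkhoff τ f n x ≤ maxBirkhoff τ f (n + 1) x := by
  induction n with
  | zero => exact fun x => maxBirkhoff_nonneg 1 x
  | succ n ih =>
    intro x
    have := ih (τ x)
    simp only [maxBirkhoff] at this ⊢
    gcongr

lemma maxBirkhoff_mono (x : α) : Monotone fun n => maxBirkhoff τ f n x :=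
  monotone_nat_of_le_succ fun n => maxBirkhoff_le_succ n x

lemma birkhoffSum_le_maxBirkhoff (n : ℕ) : ∀ x, birkhoffSum τ f n x ≤ maxBirkhoff τ f n x := by
  induction n with
  | zero => intro x; simp [maxBirkhoff]
  | succ n ih =>
    intro x
    rw [birkhoffSum_succ']
    exact le_max_of_le_right (by linarith [ih (τ x)])

lemma exists_birkhoffSum_eq_maxBirkhoff (n : ℕ) :
    ∀ x, ∃ k, maxBirkhoff τ f n x = birkhoffSum τ f k x := by
  induction n with
  | zero => exact fun x => ⟨0, by simp [maxBirkhoff]⟩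
  | succ n ih =>
    intro x
    obtain ⟨k, hk⟩ := ih (τ x)
    rcases max_choice 0 (f x + maxBirkhoff τ f n (τ x)) with h | h
    · exact ⟨0, by simpa [maxBirkhoff] using h⟩
    · exact ⟨k + 1, by rw [birkhoffSum_succ', ← hk]; exact h⟩

/-- The recursion changes the maxima along the orbit by at most a quantity depending on f x, so
boundedness is an invariant event and ergodicity makes it trivial. -/
lemma bddAbove_maxBirkhoff_iff (x : α) :
    BddAbove (Set.range fun n => maxBirkhoff τ f n (τ x)) ↔
      BddAbove (Set.range fun n => maxBirkhoff τ f n x) := by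
  constructor
  · rintro ⟨C, hC⟩
    refine ⟨max 0 (f x + C), ?_⟩
    rintro _ ⟨n, rfl⟩
    refine (maxBirkhoff_le_succ n x).trans ?_
    have := hC ⟨n, rfl⟩
    simp only [maxBirkhoff] at this ⊢
    gcongr
  · rintro ⟨C, hC⟩
    refine ⟨C - f x, ?_⟩
    rintro _ ⟨n, rfl⟩
    have h1 : maxBirkhoff τ f (n + 1) x ≤ C := hC ⟨n + 1, rfl⟩
    have h2 : f x + maxBirkhoff τ f n (τ x) ≤ maxBirkhoff τ f (n + 1) x := le_max_right _ _
    show maxBirkhoff τ f n (τ x) ≤ _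
    linarith

variable [MeasurableSpace α] {ν : Measure α}

lemma measurable_maxBirkhoff (hτ : Measurable τ) (hf : Measurable f) (n : ℕ) :
    Measurable (maxBirkhoff τ f n) := by
  induction n with
  | zero => exact measurable_const
  | succ n ih => exact measurable_const.max (hf.add (ih.comp hτ))

lemma integrable_maxBirkhoff [IsFiniteMeasure ν] (hτ : MeasurePreserving τ ν ν)
    (hf : Integrable f ν) (n : ℕ) : Integrable (maxBirkhoff τ f n) ν := by
  induction n with
  | zero => exact integrable_const 0
  | succ n ih =>
    exact (integrable_const (0 : ℝ)).sup (hf.add (hτ.integrable_comp_of_integrable ih))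

/-- The Birkhoff sums of a function with negative mean are almost surely bounded above. -/
lemma ae_bddAbove_birkhoffSum [IsProbabilityMeasure ν] (hτ : Ergodic τ ν) (hf : Measurable f)
    (hfi : Integrable f ν) (hneg : ∫ x, f x ∂ν < 0) :
    ∀ᵐ x ∂ν, BddAbove (Set.range fun n => birkhoffSum τ f n x) := by
  have hM := fun n => measurable_maxBirkhoff hτ.measurable hf n
  have hMi := fun n => integrable_maxBirkhoff hτ.toMeasurePreserving hfi n
  set A : Set α := {x | BddAbove (Set.range fun n => maxBirkhoff τ f n x)} with hA
  have hAm : MeasurableSet A := measurableSet_bddAbove_range hM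
  have hinv : τ ⁻¹' A = A := by
    ext x
    exact bddAbove_maxBirkhoff_iff x
  rcases hτ.toPreErgodic.ae_mem_or_ae_notMem hAm hinv with h | h
  · filter_upwards [h] with x hx
    obtain ⟨C, hC⟩ := hx
    refine ⟨C, ?_⟩
    rintro _ ⟨n, rfl⟩
    exact (birkhoffSum_le_maxBirkhoff n x).trans (hC ⟨n, rfl⟩)
  · exfalso
    -- The integrals of these differences are nonnegative by invariance of ν. If the maxima are
    -- almost surely unbounded, the differences max(-M_n ∘ τ, f) converge to f, which forces ∫ f ≥
    -- 0.
    set d : ℕ → α → ℝ := fun n x => maxBirkhoff τ f (n + 1) x - maxBirkhoff τ f n (τ x) with hd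
    have hdi : ∀ n, 0 ≤ ∫ x, d n x ∂ν := by
      intro n
      have hcomp : Integrable (fun x => maxBirkhoff τ f n (τ x)) ν :=
        hτ.toMeasurePreserving.integrable_comp_of_integrable (hMi n)
      simp only [hd]
      rw [integral_sub (hMi _) hcomp]
      have : ∫ x, maxBirkhoff τ f n (τ x) ∂ν = ∫ x, maxBirkhoff τ f n x ∂ν := by
        conv_rhs => rw [← hτ.toMeasurePreserving.map_eq]
        rw [integral_map hτ.measurable.aemeasurable (hM n).aestronglyMeasurable]
      rw [this]
      exact sub_nonneg.2 (integral_mono (hMi n) (hMi _) (maxBirkhoff_le_succ n))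
    have hdeq : ∀ n x, d n x = max (-maxBirkhoff τ f n (τ x)) (f x) := by
      intro n x
      simp only [hd, maxBirkhoff]
      rw [← max_sub_sub_right]
      simp
    have hlim : Tendsto (fun n => ∫ x, d n x ∂ν) atTop (nhds (∫ x, f x ∂ν)) := by
      refine tendsto_integral_of_dominated_convergence (fun x => |f x|)
        (fun n => ((hM _).sub ((hM n).comp hτ.measurable)).aestronglyMeasurable) hfi.abs ?_ ?_
      · intro n
        refine Eventually.of_forall fun x => ?_
        have h0 := maxBirkhoff_nonneg (τ := τ) (f := f) n (τ x)
        rw [hdeq, Real.norm_eq_abs, abs_le]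
        refine ⟨?_, max_le ?_ (le_abs_self _)⟩
        · exact le_max_of_le_right (neg_abs_le _)
        · linarith [abs_nonneg (f x)]
      · filter_upwards [h] with x hx
        have hx' : ¬ BddAbove (Set.range fun n => maxBirkhoff τ f n (τ x)) := fun hb =>
          hx ((bddAbove_maxBirkhoff_iff x).1 hb)
        have ht := tendsto_atTop_atTop_of_monotone (maxBirkhoff_mono (τ := τ) (f := f) (τ x))
          (fun b => by
            by_contra hcon
            push Not at hcon
            exact hx' ⟨b, by rintro _ ⟨n, rfl⟩; exact (hcon n).le⟩)
        refine tendsto_const_nhds.congr' ?_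
        filter_upwards [ht.eventually_ge_atTop (-f x)] with n hn
        rw [hdeq, max_eq_right (by linarith)]
    exact absurd (ge_of_tendsto' hlim hdi) (not_le.2 hneg)

/-- Subtracting a constant a strictly between the mean and b makes the mean negative; the bounded
sums that result are absorbed by the slack n(b - a). -/
lemma ae_eventually_birkhoffSum_le [IsProbabilityMeasure ν] (hτ : Ergodic τ ν)
    (hf : Measurable f) (hfi : Integrable f ν) {b : ℝ} (hb : ∫ x, f x ∂ν < b) :
    ∀ᵐ x ∂ν, ∀ᶠ n : ℕ in atTop, birkhoffSum τ f n x ≤ n * b := by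
  obtain ⟨a, ha, hab⟩ := exists_between hb
  have h := ae_bddAbove_birkhoffSum hτ (hf.sub_const a) (hfi.sub (integrable_const a)) (by
    rw [integral_sub hfi (integrable_const a)]
    simpa using ha)
  filter_upwards [h] with x ⟨C, hC⟩
  have ht : Tendsto (fun n : ℕ => (n : ℝ) * (b - a)) atTop atTop :=
    tendsto_natCast_atTop_atTop.atTop_mul_const (sub_pos.2 hab)
  filter_upwards [ht.eventually_ge_atTop C] with n hn
  have h1 : birkhoffSum τ (fun x => f x - a) n x ≤ C := hC ⟨n, rfl⟩
  have h2 : birkhoffSum τ (fun x => f x - a) n x = birkhoffSum τ f n x - n * a := by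
    simp [birkhoffSum]
  linarith

/-- Birkhoff's pointwise ergodic theorem for an ergodic transformation. -/
theorem ae_tendsto_birkhoffSum [IsProbabilityMeasure ν] (hτ : Ergodic τ ν)
    (hf : Measurable f) (hfi : Integrable f ν) :
    ∀ᵐ x ∂ν, Tendsto (fun n : ℕ => (1 / (n : ℝ)) * birkhoffSum τ f n x) atTop
      (nhds (∫ x, f x ∂ν)) := by
  have h1 : ∀ q : ℚ, ∫ x, f x ∂ν < q →
      ∀ᵐ x ∂ν, ∀ᶠ n : ℕ in atTop, birkhoffSum τ f n x ≤ n * q :=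
    fun q hq => ae_eventually_birkhoffSum_le hτ hf hfi hq
  have h2 : ∀ q : ℚ, (q : ℝ) < ∫ x, f x ∂ν →
      ∀ᵐ x ∂ν, ∀ᶠ n : ℕ in atTop, (n * q : ℝ) ≤ birkhoffSum τ f n x := by
    intro q hq
    have := ae_eventually_birkhoffSum_le (f := -f) (b := -q) hτ hf.neg hfi.neg (by
      simpa [integral_neg] using hq)
    filter_upwards [this] with x hx
    filter_upwards [hx] with n hn
    rw [birkhoffSum_neg] at hn
    linarith
  have h1' := ae_all_iff.2 fun q : ℚ => Filter.eventually_imp_distrib_left.2 (h1 q)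
  have h2' := ae_all_iff.2 fun q : ℚ => Filter.eventually_imp_distrib_left.2 (h2 q)
  filter_upwards [h1', h2'] with x hx1 hx2
  refine tendsto_order.2 ⟨fun a ha => ?_, fun a ha => ?_⟩
  · obtain ⟨q, hq1, hq2⟩ := exists_rat_btwn ha
    filter_upwards [hx2 q hq2, eventually_gt_atTop 0] with n hn hn0
    have hn0' : (0 : ℝ) < n := Nat.cast_pos.2 hn0
    rw [one_div, inv_mul_eq_div, lt_div_iff₀ hn0']
    nlinarith
  · obtain ⟨q, hq1, hq2⟩ := exists_rat_btwn ha
    filter_upwards [hx1 q hq1, eventually_gt_atTop 0] with n hn hn0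
    have hn0' : (0 : ℝ) < n := Nat.cast_pos.2 hn0
    rw [one_div, inv_mul_eq_div, div_lt_iff₀ hn0']
    nlinarith

/-- The lower half of the ergodic theorem for a nonnegative function that need not be
integrable. -/
lemma ae_eventually_lt_birkhoffSum [IsProbabilityMeasure ν] (hτ : Ergodic τ ν)
    (hf : Measurable f) (hf0 : ∀ x, 0 ≤ f x) {a : ℝ}
    (ha : ¬ (Integrable f ν ∧ ∫ x, f x ∂ν ≤ a)) :
    ∀ᵐ x ∂ν, ∀ᶠ n : ℕ in atTop, a < (1 / (n : ℝ)) * birkhoffSum τ f n x := by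
  have hmin : ∀ M : ℕ, Integrable (fun x => min (f x) M) ν := fun M =>
    Integrable.of_bound (hf.min measurable_const).aestronglyMeasurable M
      (Eventually.of_forall fun x => by
        rw [Real.norm_eq_abs, abs_of_nonneg (le_min (hf0 x) (Nat.cast_nonneg M))]
        exact min_le_right _ _)
  -- If every truncation had mean at most a, monotone convergence would make f integrable with mean
  -- at most a.
  obtain ⟨M, hM⟩ : ∃ M : ℕ, a < ∫ x, min (f x) M ∂ν := by
    by_contra hcon
    push Not at hcon
    apply ha
    have hsup : ∫⁻ x, ENNReal.ofReal (f x) ∂ν ≤ ENNReal.ofReal a := by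
      have : ∀ x, ENNReal.ofReal (f x) = ⨆ M : ℕ, ENNReal.ofReal (min (f x) M) := by
        intro x
        refine le_antisymm ?_ (iSup_le fun M => ENNReal.ofReal_le_ofReal (min_le_left _ _))
        obtain ⟨M, hM⟩ := exists_nat_ge (f x)
        exact le_iSup_of_le M (by rw [min_eq_left hM])
      simp_rw [this]
      rw [lintegral_iSup (fun M => (hf.min measurable_const).ennreal_ofReal)]
      · refine iSup_le fun M => ?_
        rw [← ofReal_integral_eq_lintegral_ofReal (hmin M)
          (Eventually.of_forall fun x => le_min (hf0 x) (Nat.cast_nonneg M))]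
        exact ENNReal.ofReal_le_ofReal (hcon M)
      · intro M N hMN x
        exact ENNReal.ofReal_le_ofReal (min_le_min_left _ (Nat.cast_le.2 hMN))
    have hfi : Integrable f ν := by
      refine ⟨hf.aestronglyMeasurable, ?_⟩
      rw [hasFiniteIntegral_iff_ofReal (Eventually.of_forall hf0)]
      exact hsup.trans_lt ENNReal.ofReal_lt_top
    refine ⟨hfi, ?_⟩
    have ha0 : 0 ≤ a := by
      refine le_trans (integral_nonneg fun x => ?_) (hcon 0)
      exact le_min (hf0 x) (by simp)
    rw [← ofReal_integral_eq_lintegral_ofReal hfi (Eventually.of_forall hf0)] at hsup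
    exact (ENNReal.ofReal_le_ofReal_iff ha0).1 hsup
  have h := ae_tendsto_birkhoffSum hτ (hf.min (measurable_const (a := (M : ℝ)))) (hmin M)
  filter_upwards [h] with x hx
  filter_upwards [hx.eventually (lt_mem_nhds hM)] with n hn
  refine hn.trans_le ?_
  gcongr
  exact Finset.sum_le_sum fun k _ => min_le_left _ _

/-- Finitely many visits would give asymptotic frequency zero instead of ν(s) > 0. -/
lemma ae_frequently_iterate_mem [IsProbabilityMeasure ν] (hτ : Ergodic τ ν) {s : Set α}
    (hs : MeasurableSet s) (hs0 : ν s ≠ 0) : ∀ᵐ x ∂ν, ∃ᶠ n in atTop, τ^[n] x ∈ s := by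
  have hpos : 0 < ν.real s := ENNReal.toReal_pos hs0 (measure_ne_top _ _)
  have hone := ae_tendsto_birkhoffSum (f := s.indicator 1) hτ (measurable_one.indicator hs)
    ((integrable_const (1 : ℝ)).indicator hs)
  rw [integral_indicator_one hs] at hone
  filter_upwards [hone] with x hx
  by_contra hcon
  rw [not_frequently, eventually_atTop] at hcon
  obtain ⟨N, hN⟩ := hcon
  have hbd : ∀ n, birkhoffSum τ (s.indicator (1 : α → ℝ)) n x ≤ N := by
    intro n
    calc birkhoffSum τ (s.indicator (1 : α → ℝ)) n x
        ≤ ∑ k ∈ Finset.range n, if k < N then (1 : ℝ) else 0 := by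
          refine Finset.sum_le_sum fun k _ => ?_
          by_cases hk : k < N
          · rw [if_pos hk]
            exact Set.indicator_le_self' (fun _ _ => zero_le_one) _
          · rw [if_neg hk, Set.indicator_of_notMem (hN k (not_lt.1 hk))]
      _ ≤ N := by
          rw [← Finset.sum_filter, Finset.sum_const, nsmul_eq_mul, mul_one]
          refine Nat.cast_le.2 ((Finset.card_le_card (t := Finset.range N) ?_).trans (by simp))
          intro k hk
          simp at hk ⊢
          exact hk.2
  have h0 : Tendsto (fun n : ℕ => (1 / (n : ℝ)) * N) atTop (nhds (0 * N)) :=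
    tendsto_one_div_atTop_nhds_zero_nat.mul_const _
  have := le_of_tendsto_of_tendsto' hx h0 fun n => by
    gcongr
    exact hbd n
  linarith

/-- A function along an ergodic orbit returns below its starting value infinitely often. -/
lemma ae_frequently_iterate_le [IsProbabilityMeasure ν] (hτ : Ergodic τ ν) {g : α → ℝ}
    (hg : Measurable g) : ∀ᵐ x ∂ν, ∃ᶠ n in atTop, g (τ^[n] x) ≤ g x := by
  -- Points whose late orbit stays strictly above its starting value. By Poincaré recurrence such an
  -- orbit returns to `F`, at a strictly higher value, and then stays above a rational q > g x. But
  -- {g < q} has positive measure, so it is visited infinitely often.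
  set F : Set α := {x | ∀ᶠ n in atTop, g x < g (τ^[n] x)} with hF
  have hFm : MeasurableSet F := by
    have : F = ⋃ N, ⋂ n ≥ N, {x | g x < g (τ^[n] x)} := by
      ext x
      simp [hF, eventually_atTop]
    rw [this]
    exact MeasurableSet.iUnion fun N => MeasurableSet.iInter fun n => MeasurableSet.iInter fun _ =>
      measurableSet_lt hg (hg.comp (hτ.measurable.iterate n))
  have hrec := hτ.toMeasurePreserving.conservative.ae_mem_imp_frequently_image_mem
    hFm.nullMeasurableSet
  have hnull : ∀ᵐ x ∂ν, ∀ q : ℚ, ν {y | g y < q} = 0 → (q : ℝ) ≤ g x := by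
    refine ae_all_iff.2 fun q => ?_
    by_cases h : ν {y | g y < q} = 0
    · filter_upwards [measure_eq_zero_iff_ae_notMem.1 h] with x hx _
      simpa using hx
    · exact Eventually.of_forall fun x h' => absurd h' h
  have hvis : ∀ᵐ x ∂ν, ∀ q : ℚ, ν {y | g y < q} ≠ 0 → ∃ᶠ n in atTop, g (τ^[n] x) < q := by
    refine ae_all_iff.2 fun q => ?_
    by_cases h : ν {y | g y < q} = 0
    · exact Eventually.of_forall fun x h' => absurd h h'
    · filter_upwards [ae_frequently_iterate_mem hτ (measurableSet_lt hg measurable_const) h]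
        with x hx _ using hx
  filter_upwards [hrec, hnull, hvis] with x hx1 hx2 hx3
  by_contra hcon
  have hxF : x ∈ F := by
    rw [not_frequently] at hcon
    exact hcon.mono fun n hn => not_le.1 hn
  obtain ⟨n, hn, hyF⟩ := ((hxF : ∀ᶠ n in atTop, g x < g (τ^[n] x)).and_frequently (hx1 hxF)).exists
  obtain ⟨q, hq1, hq2⟩ := exists_rat_btwn hn
  have hq : ν {y | g y < q} ≠ 0 := fun h => absurd (hx2 q h) (not_le.2 hq1)
  have hfr := hx3 q hq
  have hev : ∀ᶠ k in atTop, (q : ℝ) < g (τ^[k] x) := by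
    obtain ⟨N, hN⟩ := eventually_atTop.1 (hyF : ∀ᶠ k in atTop, _ < g (τ^[k] (τ^[n] x)))
    filter_upwards [eventually_ge_atTop (N + n)] with k hk
    have := hN (k - n) (by omega)
    rw [← Function.iterate_add_apply, Nat.sub_add_cancel (by omega)] at this
    exact hq2.trans this
  obtain ⟨k, hk1, hk2⟩ := (hfr.and_eventually hev).exists
  exact absurd hk1 (not_lt.2 hk2.le)

/-- The Birkhoff sums of a function with mean zero are infinitely often nonpositive. -/
theorem ae_frequently_birkhoffSum_nonpos [IsProbabilityMeasure ν] (hτ : Ergodic τ ν)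
    (hf : Measurable f) (hfi : Integrable f ν) (hzero : ∫ x, f x ∂ν = 0) :
    ∀ᵐ x ∂ν, ∃ᶠ n in atTop, birkhoffSum τ f n x ≤ 0 := by
  set f' : α → ℝ := -f with hf'
  have hM := fun n => measurable_maxBirkhoff hτ.measurable (hf.neg : Measurable f') n
  set A : Set α := {x | BddAbove (Set.range fun n => maxBirkhoff τ f' n x)} with hA
  have hAm : MeasurableSet A := measurableSet_bddAbove_range hM
  have hinv : τ ⁻¹' A = A := by
    ext x
    exact bddAbove_maxBirkhoff_iff x
  rcases hτ.toPreErgodic.ae_mem_or_ae_notMem hAm hinv with h | h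
  · -- here `f` is a coboundary
    -- The recursion gives g ∘ τ ≤ f + g wherever the supremum is finite. The defect f + g - g ∘ τ
    -- is nonnegative and will turn out to have mean zero.
    set g : α → ℝ := fun x => ⨆ n, maxBirkhoff τ f' n x with hg
    have hgm : Measurable g := Measurable.iSup hM
    have hg0 : ∀ x, 0 ≤ g x := fun x => Real.iSup_nonneg fun n => maxBirkhoff_nonneg n x
    have hle : ∀ᵐ x ∂ν, 0 ≤ f x + g x - g (τ x) := by
      filter_upwards [h] with x hx
      have : g (τ x) ≤ f x + g x := ciSup_le fun n => by
        have h1 : maxBirkhoff τ f' (n + 1) x ≤ g x := le_ciSup hx (n + 1)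
        have h2 : f' x + maxBirkhoff τ f' n (τ x) ≤ maxBirkhoff τ f' (n + 1) x :=
          le_max_right _ _
        simp only [hf', Pi.neg_apply] at h1 h2 ⊢
        linarith
      linarith
    set h0 : α → ℝ := fun x => max 0 (f x + g x - g (τ x)) with hh0
    have hh0m : Measurable h0 :=
      measurable_const.max ((hf.add hgm).sub (hgm.comp hτ.measurable))
    have hsum : ∀ᵐ x ∂ν, ∀ n, birkhoffSum τ h0 n x
        = birkhoffSum τ f n x + g x - g (τ^[n] x) := by
      have hall : ∀ᵐ x ∂ν, ∀ n, 0 ≤ f (τ^[n] x) + g (τ^[n] x) - g (τ (τ^[n] x)) :=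
        ae_all_iff.2 fun n =>
          (hτ.toMeasurePreserving.iterate n).quasiMeasurePreserving.ae hle
      filter_upwards [hall] with x hx n
      induction n with
      | zero => simp
      | succ n ih =>
        rw [birkhoffSum_succ, birkhoffSum_succ, ih, Function.iterate_succ_apply']
        simp only [hh0]
        rw [max_eq_right (hx n)]
        ring
    have hbirk := ae_tendsto_birkhoffSum hτ hf hfi
    rw [hzero] at hbirk
    -- Since g ≥ 0, the sums of `h0` are at most those of f plus g x, so their averages cannot have
    -- a positive lower limit. A positive mean, or a failure of integrability, would force one.
    have hint : Integrable h0 ν ∧ ∫ x, h0 x ∂ν ≤ 0 := by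
      by_contra hcon
      have hbad := ae_eventually_lt_birkhoffSum hτ hh0m (fun x => le_max_left _ _)
        (a := 0) hcon
      by_cases hi : Integrable h0 ν
      · have hpos : 0 < ∫ x, h0 x ∂ν := by
          by_contra hc
          exact hcon ⟨hi, not_lt.1 hc⟩
        have hb2 := ae_tendsto_birkhoffSum hτ hh0m hi
        obtain ⟨x, h1, h2, h3⟩ := (hsum.and (hbirk.and hb2)).exists
        have hz : Tendsto (fun n : ℕ => (1 / (n : ℝ)) * birkhoffSum τ f n x
            + (1 / (n : ℝ)) * g x) atTop (nhds (0 + 0 * g x)) :=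
          h2.add (tendsto_one_div_atTop_nhds_zero_nat.mul_const _)
        have := le_of_tendsto_of_tendsto' h3 hz fun n => by
          rw [h1 n, ← mul_add]
          gcongr
          linarith [hg0 (τ^[n] x)]
        linarith
      · have hb2 := ae_eventually_lt_birkhoffSum hτ hh0m (fun x => le_max_left _ _)
          (a := 1) (fun hc => hi hc.1)
        obtain ⟨x, h1, h2, h3⟩ := (hsum.and (hbirk.and hb2)).exists
        have hz : Tendsto (fun n : ℕ => (1 / (n : ℝ)) * birkhoffSum τ f n x
            + (1 / (n : ℝ)) * g x) atTop (nhds (0 + 0 * g x)) :=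
          h2.add (tendsto_one_div_atTop_nhds_zero_nat.mul_const _)
        have := ge_of_tendsto hz (h3.mono fun n hn => by
          refine hn.le.trans ?_
          rw [h1 n, ← mul_add]
          gcongr
          linarith [hg0 (τ^[n] x)])
        linarith
    have hae : ∀ᵐ x ∂ν, h0 x = 0 := by
      have h1 : ∫ x, h0 x ∂ν = 0 :=
        le_antisymm hint.2 (integral_nonneg fun x => le_max_left _ _)
      exact (integral_eq_zero_iff_of_nonneg (fun x => le_max_left _ _) hint.1).1 h1
    have hall : ∀ᵐ x ∂ν, ∀ n, h0 (τ^[n] x) = 0 := ae_all_iff.2 fun n =>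
      (hτ.toMeasurePreserving.iterate n).quasiMeasurePreserving.ae hae
    -- Now the n-th sum of f is g(τⁿ x) - g x, so a return of g below its starting value is a
    -- nonpositive sum.
    filter_upwards [hall, hsum, ae_frequently_iterate_le hτ hgm] with x hx1 hx2 hx3
    refine hx3.mono fun n hn => ?_
    have h1 := hx2 n
    have h2 : birkhoffSum τ h0 n x = 0 := Finset.sum_eq_zero fun k _ => hx1 k
    linarith
  -- Were all sums of f positive from time N on, those of -f would be negative there, and the
  -- maximum up to N would bound all maxima.
  · filter_upwards [h] with x hx
    by_contra hcon
    rw [not_frequently, eventually_atTop] at hcon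
    obtain ⟨N, hN⟩ := hcon
    apply hx
    refine ⟨maxBirkhoff τ f' N x, ?_⟩
    rintro _ ⟨n, rfl⟩
    obtain ⟨k, hk⟩ := exists_birkhoffSum_eq_maxBirkhoff (τ := τ) (f := f') n x
    simp only [hk]
    rcases lt_or_ge k N with hkN | hkN
    · exact (birkhoffSum_le_maxBirkhoff k x).trans (maxBirkhoff_mono x hkN.le)
    · have := hN k hkN
      rw [hf', birkhoffSum_neg]
      linarith [maxBirkhoff_nonneg (τ := τ) (f := f') N x]

end Ergodic

/-! ### Log-Laplace transform of a nonnegative function and its limit at infinity -/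

section OneLetter

variable {T : Type*} [MeasurableSpace T]

/-- The Laplace transform `t ↦ ∫ exp (-t u) dQ` of a nonnegative function. -/
noncomputable def laplace (Q : Measure T) (u : T → ℝ≥0) (t : ℝ) : ℝ :=
  ∫ y, Real.exp (-(t * u y)) ∂Q

/-- The negative logarithm of the Laplace transform. -/
noncomputable def cumulant (Q : Measure T) (u : T → ℝ≥0) (t : ℝ) : ℝ :=
  -Real.log (laplace Q u t)

/-- The mean of `u` under the probability measure proportional to `exp (-t u) dQ`. -/
noncomputable def tiltedMean (Q : Measure T) (u : T → ℝ≥0) (t : ℝ) : ℝ :=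
  (∫ y, u y * Real.exp (-(t * u y)) ∂Q) / laplace Q u t

/-- The essential infimum of `u`, as the limit of `cumulant Q u n / n`. -/
noncomputable def essMin (Q : Measure T) (u : T → ℝ≥0) : ℝ :=
  ⨅ n : ℕ, cumulant Q u (n + 1) / (n + 1)

/-- The set where `u` attains its essential infimum, or everything if that set is null. -/
def minSet (Q : Measure T) (u : T → ℝ≥0) : Set T :=
  {y | (u y : ℝ) ≤ essMin Q u ∨ Q {y | (u y : ℝ) ≤ essMin Q u} = 0}

variable {Q : Measure T} [IsProbabilityMeasure Q] {u : T → ℝ≥0} {s t : ℝ}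

lemma integrable_exp_neg_mul (hu : Measurable u) (ht : 0 ≤ t) :
    Integrable (fun y => Real.exp (-(t * u y))) Q := by
  refine Integrable.of_bound (by fun_prop) 1 (Eventually.of_forall fun y => ?_)
  rw [Real.norm_eq_abs, abs_of_pos (Real.exp_pos _), Real.exp_le_one_iff]
  have : 0 ≤ t * u y := by positivity
  linarith

lemma mul_exp_neg_mul_le (a : ℝ) (ht : 0 < t) : a * Real.exp (-(t * a)) ≤ 1 / t := by
  rw [Real.exp_neg, ← div_eq_mul_inv, div_le_div_iff₀ (Real.exp_pos _) ht]
  linarith [Real.add_one_le_exp (t * a)]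

lemma integrable_mul_exp_neg_mul (hu : Measurable u) (ht : 0 < t) :
    Integrable (fun y => u y * Real.exp (-(t * u y))) Q := by
  refine Integrable.of_bound (by fun_prop) (1 / t) (Eventually.of_forall fun y => ?_)
  rw [Real.norm_eq_abs, abs_of_nonneg (by positivity)]
  exact mul_exp_neg_mul_le _ ht

lemma laplace_pos (hu : Measurable u) (ht : 0 ≤ t) : 0 < laplace Q u t :=
  integral_exp_pos (integrable_exp_neg_mul hu ht)

lemma laplace_le_one (hu : Measurable u) (ht : 0 ≤ t) : laplace Q u t ≤ 1 := by
  have : laplace Q u t ≤ ∫ _, (1 : ℝ) ∂Q := by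
    refine integral_mono (integrable_exp_neg_mul hu ht) (integrable_const _) fun y => ?_
    rw [Real.exp_le_one_iff]
    have : 0 ≤ t * u y := by positivity
    linarith
  simpa using this

lemma cumulant_nonneg (hu : Measurable u) (ht : 0 ≤ t) : 0 ≤ cumulant Q u t :=
  neg_nonneg.2 (Real.log_nonpos (laplace_pos hu ht).le (laplace_le_one hu ht))

lemma cumulant_zero : cumulant Q u 0 = 0 := by simp [cumulant, laplace]

lemma exp_neg_cumulant (hu : Measurable u) (ht : 0 ≤ t) :
    Real.exp (-cumulant Q u t) = laplace Q u t := by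
  rw [cumulant, neg_neg, Real.exp_log (laplace_pos hu ht)]

omit [IsProbabilityMeasure Q] in
lemma tiltedMean_nonneg : 0 ≤ tiltedMean Q u t :=
  div_nonneg (integral_nonneg fun _ => by positivity)
    (integral_nonneg fun _ => (Real.exp_pos _).le)

/-- The cumulant lies below its tangents. -/
lemma cumulant_le_tangent (hu : Measurable u) (hs : 0 < s) (ht : 0 ≤ t) :
    cumulant Q u t ≤ cumulant Q u s + (t - s) * tiltedMean Q u s := by
  set r := tiltedMean Q u s with hr
  have hZ := laplace_pos (Q := Q) hu hs.le
  have hr' : ∫ y, u y * Real.exp (-(s * u y)) ∂Q = r * laplace Q u s := by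
    rw [hr, tiltedMean, div_mul_cancel₀ _ hZ.ne']
  have h1 := (integrable_exp_neg_mul (Q := Q) hu hs.le)
  have h2 := (integrable_mul_exp_neg_mul (Q := Q) hu hs)
  -- Jensen's inequality under the law tilted by s, obtained from exp a ≥ 1 + a at a = -(t - s)(u -
  -- r); the linear term has mean zero because r is the tilted mean.
  have key : Real.exp (-((t - s) * r)) * laplace Q u s ≤ laplace Q u t := by
    have : ∫ y, Real.exp (-((t - s) * r)) * ((1 + (t - s) * r) * Real.exp (-(s * u y))
        - (t - s) * (u y * Real.exp (-(s * u y)))) ∂Q ≤ laplace Q u t := by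
      refine integral_mono (((h1.const_mul _).sub (h2.const_mul _)).const_mul _)
        (integrable_exp_neg_mul hu ht) fun y => ?_
      have h3 := Real.add_one_le_exp (-((t - s) * (u y - r)))
      have h4 : Real.exp (-(t * u y)) = Real.exp (-((t - s) * r)) * Real.exp (-(s * u y))
          * Real.exp (-((t - s) * (u y - r))) := by
        rw [← Real.exp_add, ← Real.exp_add]
        ring_nf
      have h5 : 0 ≤ Real.exp (-((t - s) * r)) * Real.exp (-(s * u y)) := by positivity
      simp only
      rw [h4]
      nlinarith [mul_le_mul_of_nonneg_left h3 h5]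
    rw [integral_const_mul, integral_sub (h1.const_mul _) (h2.const_mul _),
      integral_const_mul, integral_const_mul, hr'] at this
    refine le_trans (le_of_eq ?_) this
    rw [laplace]
    ring
  have := Real.log_le_log (by positivity) key
  rw [Real.log_mul (Real.exp_pos _).ne' hZ.ne', Real.log_exp] at this
  simp only [cumulant]
  linarith

lemma mul_tiltedMean_le (hu : Measurable u) (hs : 0 < s) :
    s * tiltedMean Q u s ≤ cumulant Q u s := by
  have := cumulant_le_tangent (Q := Q) hu hs le_rfl
  rw [cumulant_zero] at this
  linarith

/-- Add the tangent inequalities at s and at t. -/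
lemma tiltedMean_anti (hu : Measurable u) (hs : 0 < s) (hst : s ≤ t) :
    tiltedMean Q u t ≤ tiltedMean Q u s := by
  rcases hst.eq_or_lt with rfl | hlt
  · exact le_rfl
  have h1 := cumulant_le_tangent (Q := Q) hu hs (hs.le.trans hst)
  have h2 := cumulant_le_tangent (Q := Q) hu (hs.trans_le hst) hs.le
  nlinarith

/-- Dominated convergence with the integrands at t/2; staying away from zero matters because u
itself need not be integrable. -/
lemma continuousAt_tiltedMean (hu : Measurable u) (ht : 0 < t) :
    ContinuousAt (tiltedMean Q u) t := by
  have hev : ∀ᶠ s in nhds t, t / 2 < s := lt_mem_nhds (by linarith)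
  refine ContinuousAt.div ?_ ?_ (laplace_pos hu ht.le).ne'
  · refine continuousAt_of_dominated (bound := fun y => u y * Real.exp (-(t / 2 * u y)))
      (Eventually.of_forall fun s => by fun_prop) ?_ (integrable_mul_exp_neg_mul hu (by linarith))
      (Eventually.of_forall fun y => by fun_prop)
    filter_upwards [hev] with s hs
    refine Eventually.of_forall fun y => ?_
    rw [Real.norm_eq_abs, abs_of_nonneg (by positivity)]
    gcongr
  · refine continuousAt_of_dominated (bound := fun y => Real.exp (-(t / 2 * u y)))
      (Eventually.of_forall fun s => by fun_prop) ?_ (integrable_exp_neg_mul hu (by linarith))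
      (Eventually.of_forall fun y => by fun_prop)
    filter_upwards [hev] with s hs
    refine Eventually.of_forall fun y => ?_
    rw [Real.norm_eq_abs, abs_of_nonneg (by positivity)]
    gcongr

/-- The cumulant is concave and vanishes at zero, so its slopes from the origin decrease. -/
lemma cumulant_div_anti (hu : Measurable u) (hs : 0 < s) (hst : s ≤ t) :
    cumulant Q u t / t ≤ cumulant Q u s / s := by
  have ht := hs.trans_le hst
  have h1 := cumulant_le_tangent (Q := Q) hu hs ht.le
  have h2 := mul_tiltedMean_le (Q := Q) hu hs
  rw [div_le_div_iff₀ ht hs]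
  nlinarith [mul_le_mul_of_nonneg_left h2 (sub_nonneg.2 hst)]

lemma essMin_bddBelow (hu : Measurable u) :
    BddBelow (Set.range fun n : ℕ => cumulant Q u (n + 1) / (n + 1)) := by
  refine ⟨0, ?_⟩
  rintro _ ⟨n, rfl⟩
  exact div_nonneg (cumulant_nonneg hu (by positivity)) (by positivity)

lemma essMin_nonneg (hu : Measurable u) : 0 ≤ essMin Q u :=
  le_ciInf fun n => div_nonneg (cumulant_nonneg hu (by positivity)) (by positivity)

lemma antitone_cumulant_div (hu : Measurable u) :
    Antitone fun n : ℕ => cumulant Q u (n + 1) / (n + 1) := fun m n hmn =>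
  cumulant_div_anti hu (by positivity) (by gcongr)

lemma tendsto_cumulant_div (hu : Measurable u) :
    Tendsto (fun n : ℕ => cumulant Q u (n + 1) / (n + 1)) atTop (nhds (essMin Q u)) :=
  tendsto_atTop_ciInf (antitone_cumulant_div hu) (essMin_bddBelow hu)

lemma mul_essMin_le (hu : Measurable u) (n : ℕ) :
    (n + 1) * essMin Q u ≤ cumulant Q u (n + 1) := by
  have := ciInf_le (essMin_bddBelow (Q := Q) hu) n
  rw [le_div_iff₀ (by positivity)] at this
  rw [mul_comm]
  exact this

/-- A Chernoff bound: {u ≤ essMin - δ} contributes Q(A) exp(-(n+1)(essMin - δ)) to a Laplace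
transform that is at most exp(-(n+1) essMin), so Q(A) ≤ exp(-(n+1)δ) for every n. -/
lemma ae_essMin_le (hu : Measurable u) : ∀ᵐ y ∂Q, essMin Q u ≤ u y := by
  have hδ : ∀ k : ℕ, ∀ᵐ y ∂Q, essMin Q u - 1 / (k + 1) < u y := by
    intro k
    set δ : ℝ := 1 / (k + 1) with hδ
    have hδ0 : 0 < δ := by positivity
    set A : Set T := {y | (u y : ℝ) ≤ essMin Q u - δ} with hA
    have hAm : MeasurableSet A := measurableSet_le (by fun_prop) measurable_const
    have hb : ∀ n : ℕ, Q.real A ≤ Real.exp (-((n + 1) * δ)) := by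
      intro n
      have h1 : Real.exp (-((n + 1) * (essMin Q u - δ))) * Q.real A
          ≤ laplace Q u (n + 1) := by
        rw [← integral_indicator_one hAm, ← integral_const_mul]
        refine integral_mono (((integrable_const (1 : ℝ)).indicator hAm).const_mul _)
          (integrable_exp_neg_mul hu (by positivity)) fun y => ?_
        by_cases hy : y ∈ A
        · simp only [Set.indicator_of_mem hy, Pi.one_apply, mul_one, Real.exp_le_exp]
          have : (u y : ℝ) ≤ essMin Q u - δ := hy
          have hn : (0 : ℝ) ≤ n + 1 := by positivity
          nlinarith
        · simp only [Set.indicator_of_notMem hy, mul_zero]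
          positivity
      have h2 : laplace Q u (n + 1) ≤ Real.exp (-((n + 1) * essMin Q u)) := by
        rw [← exp_neg_cumulant hu (by positivity), Real.exp_le_exp]
        linarith [mul_essMin_le (Q := Q) hu n]
      have h3 := h1.trans h2
      rw [← le_div_iff₀' (Real.exp_pos _), ← Real.exp_sub] at h3
      refine h3.trans (le_of_eq ?_)
      congr 1
      ring
    have hlim : Tendsto (fun n : ℕ => Real.exp (-(((n : ℝ) + 1) * δ))) atTop (nhds 0) := by
      refine Real.tendsto_exp_neg_atTop_nhds_zero.comp ?_
      exact (tendsto_atTop_add_const_right _ _ tendsto_natCast_atTop_atTop).atTop_mul_const hδ0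
    have h0 : Q.real A = 0 := le_antisymm (ge_of_tendsto' hlim hb) measureReal_nonneg
    have h0' : Q A = 0 := (measureReal_eq_zero_iff (measure_ne_top _ _)).1 h0
    filter_upwards [measure_eq_zero_iff_ae_notMem.1 h0'] with y hy
    exact not_le.1 hy
  filter_upwards [ae_all_iff.2 hδ] with y hy
  have hlim : Tendsto (fun k : ℕ => essMin Q u - 1 / ((k : ℝ) + 1)) atTop
      (nhds (essMin Q u - 0)) := tendsto_const_nhds.sub tendsto_one_div_add_atTop_nhds_zero_nat
  rw [sub_zero] at hlim
  exact le_of_tendsto' hlim fun k => (hy k).le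

omit [IsProbabilityMeasure Q] in
lemma measurableSet_le_essMin (hu : Measurable u) :
    MeasurableSet {y | (u y : ℝ) ≤ essMin Q u} :=
  measurableSet_le (by fun_prop) measurable_const

/-- The left side is the Laplace transform of u - essMin, which is almost surely nonnegative; as the
parameter grows only the zero set of this function survives. -/
lemma tendsto_exp_neg_cumulant_sub (hu : Measurable u) :
    Tendsto (fun n : ℕ => Real.exp (-(cumulant Q u (n + 1) - (n + 1) * essMin Q u))) atTop
      (nhds (Q.real {y | (u y : ℝ) ≤ essMin Q u})) := by
  set A := {y | (u y : ℝ) ≤ essMin Q u} with hA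
  have hAm : MeasurableSet A := measurableSet_le_essMin hu
  have heq : ∀ n : ℕ, Real.exp (-(cumulant Q u (n + 1) - (n + 1) * essMin Q u))
      = ∫ y, Real.exp (-((n + 1) * (u y - essMin Q u))) ∂Q := by
    intro n
    rw [neg_sub, sub_eq_add_neg, Real.exp_add, exp_neg_cumulant hu (by positivity), laplace,
      ← integral_const_mul]
    congr 1 with y
    rw [← Real.exp_add]
    ring_nf
  simp_rw [heq]
  rw [← integral_indicator_one hAm]
  refine tendsto_integral_of_dominated_convergence (fun _ => 1)
    (fun n => by fun_prop) (integrable_const _) ?_ ?_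
  · intro n
    filter_upwards [ae_essMin_le hu] with y hy
    rw [Real.norm_eq_abs, abs_of_pos (Real.exp_pos _), Real.exp_le_one_iff]
    have := mul_nonneg (by positivity : (0 : ℝ) ≤ n + 1) (sub_nonneg.2 hy)
    linarith
  · filter_upwards [ae_essMin_le hu] with y hy
    rcases hy.eq_or_lt with h | h
    · have hyA : y ∈ A := h.ge
      simp [Set.indicator_of_mem hyA, h]
    · have hyA : y ∉ A := not_le.2 h
      rw [Set.indicator_of_notMem hyA]
      refine Real.tendsto_exp_neg_atTop_nhds_zero.comp ?_
      exact (tendsto_atTop_add_const_right _ _ tendsto_natCast_atTop_atTop).atTop_mul_const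
        (sub_pos.2 h)

omit [IsProbabilityMeasure Q] in
lemma minSet_of_ne_zero (h : Q {y | (u y : ℝ) ≤ essMin Q u} ≠ 0) :
    minSet Q u = {y | (u y : ℝ) ≤ essMin Q u} := by
  simp [minSet, h]

lemma measure_minSet_pos : 0 < Q.real (minSet Q u) := by
  rw [measureReal_def]
  refine ENNReal.toReal_pos ?_ (measure_ne_top _ _)
  by_cases h : Q {y | (u y : ℝ) ≤ essMin Q u} = 0
  · simp [minSet, h]
  · rwa [minSet_of_ne_zero h]

end OneLetter

/-! ### The dual functional and its optimal tilts -/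

section Letters

variable {S T : Type*} [MeasurableSpace S] [MeasurableSpace T] {ρ : S × T → ℝ≥0}
  {P : Measure S} {Q : Measure T} {D c t : ℝ}

/-- The cumulant of the distortion of the letter `x`. -/
noncomputable abbrev letterCumulant (ρ : S × T → ℝ≥0) (Q : Measure T) (t : ℝ) (x : S) : ℝ :=
  cumulant Q (fun y => ρ (x, y)) t

/-- The tilted mean of the distortion of the letter `x`. -/
noncomputable abbrev letterMean (ρ : S × T → ℝ≥0) (Q : Measure T) (t : ℝ) (x : S) : ℝ :=
  tiltedMean Q (fun y => ρ (x, y)) t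

/-- The essential infimum of the distortion of the letter `x`. -/
noncomputable abbrev letterMin (ρ : S × T → ℝ≥0) (Q : Measure T) (x : S) : ℝ :=
  essMin Q fun y => ρ (x, y)

/-- The cost `-log Q(A)` of the set `A` where the distortion of the letter `x` is minimal. -/
noncomputable abbrev letterMinCost (ρ : S × T → ℝ≥0) (Q : Measure T) (x : S) : ℝ :=
  -Real.log (Q.real (minSet Q fun y => ρ (x, y)))

/-- The number `c` dominates the dual functional `t ↦ ∫ cumulant dP - t D` of the rate function. -/
def DualBound (ρ : S × T → ℝ≥0) (P : Measure S) (Q : Measure T) (D c : ℝ) : Prop :=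
  ∀ t, 0 ≤ t → Integrable (letterCumulant ρ Q t) P ∧ ∫ x, letterCumulant ρ Q t x ∂P ≤ c + t * D

variable [IsProbabilityMeasure Q]

omit [MeasurableSpace S] in
lemma letterMinCost_nonneg (x : S) : 0 ≤ letterMinCost ρ Q x :=
  neg_nonneg.2 (Real.log_nonpos measureReal_nonneg measureReal_le_one)

lemma measurable_laplace (hρ : Measurable ρ) (t : ℝ) :
    Measurable fun x => laplace Q (fun y => ρ (x, y)) t := by
  have : StronglyMeasurable fun z : S × T => Real.exp (-(t * ρ z)) :=
    Measurable.stronglyMeasurable (by fun_prop)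
  exact this.integral_prod_right'.measurable

lemma measurable_letterCumulant (hρ : Measurable ρ) (t : ℝ) :
    Measurable (letterCumulant ρ Q t) :=
  (Real.measurable_log.comp (measurable_laplace hρ t)).neg

lemma measurable_letterMean (hρ : Measurable ρ) (t : ℝ) : Measurable (letterMean ρ Q t) := by
  have : StronglyMeasurable fun z : S × T => ρ z * Real.exp (-(t * ρ z)) :=
    Measurable.stronglyMeasurable (by fun_prop)
  exact this.integral_prod_right'.measurable.div (measurable_laplace hρ t)

lemma measurable_letterMin (hρ : Measurable ρ) : Measurable (letterMin ρ Q) :=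
  Measurable.iInf fun _ => (measurable_letterCumulant hρ _).div_const _

lemma measurableSet_minSet (hρ : Measurable ρ) :
    MeasurableSet {z : S × T | z.2 ∈ minSet Q fun y => ρ (z.1, y)} := by
  have h1 : MeasurableSet {z : S × T | (ρ z : ℝ) ≤ letterMin ρ Q z.1} :=
    measurableSet_le (by fun_prop) ((measurable_letterMin hρ).comp measurable_fst)
  have h2 : Measurable fun z : S × T => Q {y | (ρ (z.1, y) : ℝ) ≤ letterMin ρ Q z.1} :=
    (measurable_measure_prodMk_left h1).comp measurable_fst
  exact h1.union (h2 (measurableSet_singleton 0))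

lemma measurable_letterMinCost (hρ : Measurable ρ) : Measurable (letterMinCost ρ Q) :=
  (Real.measurable_log.comp
    (measurable_measure_prodMk_left (measurableSet_minSet (Q := Q) hρ)).ennreal_toReal).neg

lemma integrable_letterMean (hρ : Measurable ρ) (h : DualBound ρ P Q D c) (ht : 0 < t) :
    Integrable (letterMean ρ Q t) P := by
  refine ((h t ht.le).1.div_const t).mono' (measurable_letterMean hρ t).aestronglyMeasurable
    (Eventually.of_forall fun x => ?_)
  rw [Real.norm_eq_abs, abs_of_nonneg tiltedMean_nonneg, le_div_iff₀ ht, mul_comm]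
  exact mul_tiltedMean_le (by fun_prop) ht

lemma continuousAt_integral_letterMean (hρ : Measurable ρ) (h : DualBound ρ P Q D c)
    (ht : 0 < t) : ContinuousAt (fun t => ∫ x, letterMean ρ Q t x ∂P) t := by
  refine continuousAt_of_dominated (bound := letterMean ρ Q (t / 2))
    (Eventually.of_forall fun s => (measurable_letterMean hρ s).aestronglyMeasurable) ?_
    (integrable_letterMean hρ h (by linarith))
    (Eventually.of_forall fun x => continuousAt_tiltedMean (by fun_prop) ht)
  have hev : ∀ᶠ s in nhds t, t / 2 < s := lt_mem_nhds (by linarith)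
  filter_upwards [hev] with s hs
  refine Eventually.of_forall fun x => ?_
  rw [Real.norm_eq_abs, abs_of_nonneg tiltedMean_nonneg]
  exact tiltedMean_anti (by fun_prop) (by linarith) hs.le

lemma integral_letterCumulant_le (hρ : Measurable ρ) (h : DualBound ρ P Q D c) {s : ℝ}
    (hs : 0 < s) (ht : 0 ≤ t) :
    ∫ x, letterCumulant ρ Q t x ∂P
      ≤ ∫ x, letterCumulant ρ Q s x ∂P + (t - s) * ∫ x, letterMean ρ Q s x ∂P := by
  have hi := (integrable_letterMean hρ h hs).const_mul (t - s)
  rw [← integral_const_mul, ← integral_add (h s hs.le).1 hi]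
  exact integral_mono (h t ht).1 ((h s hs.le).1.add hi) fun x =>
    cumulant_le_tangent (by fun_prop) hs ht

/-- If some tilted mean is below `D`, near-optimal tilts have mean strictly below `D`. -/
lemma exists_tilt (hρ : Measurable ρ) (h : DualBound ρ P Q D c) {t₀ : ℝ} (ht₀ : 0 < t₀)
    (hlt : ∫ x, letterMean ρ Q t₀ x ∂P < D) {ε : ℝ} (hε : 0 < ε) :
    ∃ t, 0 < t ∧ ∫ x, letterMean ρ Q t x ∂P < D ∧
      ∫ x, letterCumulant ρ Q t x ∂P - t * ∫ x, letterMean ρ Q t x ∂P ≤ c + ε := by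
  have h0 : ∀ t, 0 ≤ ∫ x, letterMean ρ Q t x ∂P := fun t =>
    integral_nonneg fun x => tiltedMean_nonneg
  have hD : 0 < D := (h0 t₀).trans_lt hlt
  -- At `t₁` the loss t₁ D is at most ε, so `t₁` works if its mean is below D. Otherwise the mean
  -- crosses D between `t₁` and `t₀`, and a tilt with mean D' slightly below D loses only t(D - D')
  -- ≤ ε.
  set t₁ := min t₀ (ε / D) with ht₁
  have ht₁0 : 0 < t₁ := lt_min ht₀ (div_pos hε hD)
  have ht₁D : t₁ * D ≤ ε := by
    calc t₁ * D ≤ ε / D * D := by gcongr; exact min_le_right _ _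
      _ = ε := div_mul_cancel₀ _ hD.ne'
  by_cases hc : ∫ x, letterMean ρ Q t₁ x ∂P < D
  · refine ⟨t₁, ht₁0, hc, ?_⟩
    have := (h t₁ ht₁0.le).2
    have := mul_nonneg ht₁0.le (h0 t₁)
    linarith
  · rw [not_lt] at hc
    obtain ⟨D', hD1, hD2⟩ := exists_between (a₁ := max (∫ x, letterMean ρ Q t₀ x ∂P) (D - ε / t₀))
      (a₂ := D) (max_lt hlt (by linarith [div_pos hε ht₀]))
    have hcont : ContinuousOn (fun t => ∫ x, letterMean ρ Q t x ∂P) (Set.Icc t₁ t₀) := fun t ht =>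
      (continuousAt_integral_letterMean hρ h (ht₁0.trans_le ht.1)).continuousWithinAt
    obtain ⟨t, ht, htD⟩ := intermediate_value_Icc' (min_le_left _ _) hcont
      (⟨(le_max_left _ _).trans hD1.le, hD2.le.trans hc⟩ : D' ∈ Set.Icc _ _)
    have ht0 : 0 < t := ht₁0.trans_le ht.1
    simp only at htD
    refine ⟨t, ht0, by rwa [htD], ?_⟩
    rw [htD]
    have h1 := (h t ht0.le).2
    have h2 : D - D' ≤ ε / t₀ := by linarith [le_max_right (∫ x, letterMean ρ Q t₀ x ∂P) (D - ε / t₀)]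
    have h3 : t * (D - D') ≤ t₀ * (ε / t₀) :=
      mul_le_mul ht.2 h2 (by linarith) ht₀.le
    rw [mul_div_cancel₀ _ ht₀.ne'] at h3
    linarith

/-- If every tilted mean is at least `D`, then `D` is the mean of the minimal distortion, and
concentrating on the minimal distortion is optimal. -/
lemma integral_letterMin_of_le_letterMean [IsProbabilityMeasure P] (hρ : Measurable ρ)
    (h : DualBound ρ P Q D c)
    (hge : ∀ t, 0 < t → D ≤ ∫ x, letterMean ρ Q t x ∂P) :
    Integrable (letterMin ρ Q) P ∧ ∫ x, letterMin ρ Q x ∂P = D ∧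
      (∀ᵐ x ∂P, Q {y | (ρ (x, y) : ℝ) ≤ letterMin ρ Q x} ≠ 0) ∧
      Integrable (letterMinCost ρ Q) P ∧ ∫ x, letterMinCost ρ Q x ∂P ≤ c := by
  have hsec : ∀ x, Measurable fun y => ρ (x, y) := fun x => by fun_prop
  have hm0 : ∀ x, 0 ≤ letterMin ρ Q x := fun x => essMin_nonneg (hsec x)
  have hmi : Integrable (letterMin ρ Q) P := by
    refine (h 1 zero_le_one).1.mono' (measurable_letterMin hρ).aestronglyMeasurable
      (Eventually.of_forall fun x => ?_)
    rw [Real.norm_eq_abs, abs_of_nonneg (hm0 x)]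
    simpa using mul_essMin_le (Q := Q) (hsec x) 0
  have hup : ∀ n : ℕ, (n + 1) * (∫ x, letterMin ρ Q x ∂P) ≤ c + (n + 1) * D := by
    intro n
    refine le_trans ?_ (h (n + 1) (by positivity)).2
    rw [← integral_const_mul]
    exact integral_mono (hmi.const_mul _) (h (n + 1) (by positivity)).1 fun x =>
      mul_essMin_le (hsec x) n
  have hle : ∫ x, letterMin ρ Q x ∂P ≤ D := by
    by_contra hcon
    rw [not_le] at hcon
    obtain ⟨n, hn⟩ := exists_nat_gt (c / (∫ x, letterMin ρ Q x ∂P - D))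
    rw [div_lt_iff₀ (sub_pos.2 hcon)] at hn
    have := hup n
    nlinarith
  -- The tangent at n + 1, evaluated at 0, bounds the cumulant below by n + 1 times the tilted mean.
  have hlow : ∀ n : ℕ, D ≤ ∫ x, letterCumulant ρ Q (n + 1) x / (n + 1) ∂P := by
    intro n
    have hn : (0 : ℝ) < n + 1 := by positivity
    have h1 := integral_letterCumulant_le hρ h hn le_rfl
    have h2 : ∫ x, letterCumulant ρ Q 0 x ∂P = 0 := by simp [letterCumulant, cumulant_zero]
    rw [integral_div, le_div_iff₀ hn]
    nlinarith [hge (n + 1) hn]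
  have hlim : Tendsto (fun n : ℕ => ∫ x, letterCumulant ρ Q (n + 1) x / (n + 1) ∂P) atTop
      (nhds (∫ x, letterMin ρ Q x ∂P)) := by
    refine tendsto_integral_of_dominated_convergence (letterCumulant ρ Q 1)
      (fun n => ((measurable_letterCumulant hρ _).div_const _).aestronglyMeasurable)
      (h 1 zero_le_one).1 ?_ (Eventually.of_forall fun x => tendsto_cumulant_div (hsec x))
    refine fun n => Eventually.of_forall fun x => ?_
    rw [Real.norm_eq_abs, abs_of_nonneg
      (div_nonneg (cumulant_nonneg (hsec x) (by positivity)) (by positivity))]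
    simpa using antitone_cumulant_div (Q := Q) (hsec x) (Nat.zero_le n)
  have hmD : ∫ x, letterMin ρ Q x ∂P = D := le_antisymm hle (ge_of_tendsto' hlim hlow)
  -- What remains of the cumulant after its linear part. Since the minima have mean exactly D, its
  -- integral is at most c; pointwise, exp(-φ) tends to the mass of the minimal set. Fatou's lemma
  -- then shows that this mass is nonzero and bounds the mean cost by c.
  set φ : ℕ → S → ℝ := fun n x => letterCumulant ρ Q (n + 1) x - (n + 1) * letterMin ρ Q x with hφ
  have hφm : ∀ n, Measurable (φ n) := fun n =>
    (measurable_letterCumulant hρ _).sub ((measurable_letterMin hρ).const_mul _)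
  have hφ0 : ∀ n x, 0 ≤ φ n x := fun n x => sub_nonneg.2 (mul_essMin_le (hsec x) n)
  have hφint : ∀ n, ∫⁻ x, ENNReal.ofReal (φ n x) ∂P ≤ ENNReal.ofReal c := by
    intro n
    have hi := (h (n + 1) (by positivity)).1
    have hφi : Integrable (φ n) P := hi.sub (hmi.const_mul _)
    rw [← ofReal_integral_eq_lintegral_ofReal hφi
      (Eventually.of_forall (hφ0 n))]
    refine ENNReal.ofReal_le_ofReal ?_
    simp only [hφ]
    rw [integral_sub hi (hmi.const_mul _), integral_const_mul, hmD]
    linarith [(h (n + 1) (by positivity)).2]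
  have hfatou : ∫⁻ x, liminf (fun n => ENNReal.ofReal (φ n x)) atTop ∂P ≤ ENNReal.ofReal c :=
    (lintegral_liminf_le fun n => (hφm n).ennreal_ofReal).trans
      (liminf_le_of_frequently_le' (Eventually.of_forall hφint).frequently)
  have hexp : ∀ x, Tendsto (fun n => Real.exp (-φ n x)) atTop
      (nhds (Q.real {y | (ρ (x, y) : ℝ) ≤ letterMin ρ Q x})) := fun x =>
    tendsto_exp_neg_cumulant_sub (hsec x)
  have hne : ∀ᵐ x ∂P, Q {y | (ρ (x, y) : ℝ) ≤ letterMin ρ Q x} ≠ 0 := by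
    filter_upwards [ae_lt_top (Measurable.liminf fun n => (hφm n).ennreal_ofReal)
      (hfatou.trans_lt ENNReal.ofReal_lt_top).ne] with x hx hzero
    have h1 := hexp x
    rw [measureReal_def, hzero, ENNReal.toReal_zero, Real.tendsto_exp_comp_nhds_zero] at h1
    have h2 : Tendsto (fun n => φ n x) atTop atTop := by simpa using tendsto_neg_atBot_iff.1 h1
    rw [(ENNReal.tendsto_ofReal_nhds_top.2 h2).liminf_eq] at hx
    exact lt_irrefl _ hx
  have hcost : ∀ᵐ x ∂P, liminf (fun n => ENNReal.ofReal (φ n x)) atTop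
      = ENNReal.ofReal (letterMinCost ρ Q x) := by
    filter_upwards [hne] with x hx
    refine Tendsto.liminf_eq (ENNReal.tendsto_ofReal ?_)
    have h1 := (hexp x).log (ENNReal.toReal_pos hx (measure_ne_top _ _)).ne'
    simp only [Real.log_exp] at h1
    simp only [letterMinCost, minSet_of_ne_zero hx]
    simpa using h1.neg
  rw [lintegral_congr_ae hcost] at hfatou
  have hci : Integrable (letterMinCost ρ Q) P := by
    refine ⟨(measurable_letterMinCost hρ).aestronglyMeasurable, ?_⟩
    rw [hasFiniteIntegral_iff_ofReal (Eventually.of_forall letterMinCost_nonneg)]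
    exact hfatou.trans_lt ENNReal.ofReal_lt_top
  have hc0 : 0 ≤ c := by
    have := (h 0 le_rfl).2
    simpa [letterCumulant, cumulant_zero] using this
  refine ⟨hmi, hmD, hne, hci, ?_⟩
  rw [← ofReal_integral_eq_lintegral_ofReal hci (Eventually.of_forall letterMinCost_nonneg)]
    at hfatou
  exact (ENNReal.ofReal_le_ofReal_iff hc0).1 hfatou

end Letters

/-! ### Gibbs inequality -/

open InformationTheory

/-- A Gibbs inequality: a function with exponential moment at most one is dominated by the log
likelihood ratio, up to a function of nonpositive mean. -/
lemma exists_le_llr_add {α : Type*} [MeasurableSpace α] {W M : Measure α}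
    [IsProbabilityMeasure W] [IsProbabilityMeasure M] (hWM : W ≪ M) {b : α → ℝ}
    (hb : Measurable b) (hb1 : ∫⁻ z, ENNReal.ofReal (Real.exp (b z)) ∂M ≤ 1) :
    ∃ v : α → ℝ, Integrable v W ∧ ∫ z, v z ∂W ≤ 1 ∧ ∀ᵐ z ∂W, b z ≤ llr W M z + v z - 1 := by
  set e : α → ℝ≥0∞ := fun z => ENNReal.ofReal (Real.exp (b z)) / W.rnDeriv M z with he
  have hem : Measurable e := by
    have := Measure.measurable_rnDeriv W M
    fun_prop
  have he1 : ∫⁻ z, e z ∂W ≤ 1 := by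
    rw [← lintegral_rnDeriv_mul hWM hem.aemeasurable]
    exact (lintegral_mono fun z => ENNReal.mul_div_le).trans hb1
  have hefin : ∫⁻ z, e z ∂W ≠ ∞ := (he1.trans_lt ENNReal.one_lt_top).ne
  refine ⟨fun z => (e z).toReal, integrable_toReal_of_lintegral_ne_top hem.aemeasurable hefin,
    ?_, ?_⟩
  · rw [integral_toReal hem.aemeasurable (ae_lt_top hem hefin)]
    exact ENNReal.toReal_le_of_le_ofReal zero_le_one (by simpa using he1)
  · filter_upwards [Measure.rnDeriv_pos hWM, hWM.ae_le (Measure.rnDeriv_lt_top W M)] with z h1 h2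
    have hu : 0 < (W.rnDeriv M z).toReal := ENNReal.toReal_pos h1.ne' h2.ne
    have h3 : (e z).toReal = Real.exp (b z) / (W.rnDeriv M z).toReal := by
      simp [he, ENNReal.toReal_div, (Real.exp_pos (b z)).le]
    have h4 := Real.log_le_sub_one_of_pos (div_pos (Real.exp_pos (b z)) hu)
    rw [Real.log_div (Real.exp_pos _).ne' hu.ne', Real.log_exp] at h4
    rw [h3, llr]
    linarith

/-! ### Duality for the rate function -/

section Rate

variable {S T : Type*} [MeasurableSpace S] [MeasurableSpace T] {ρ : S × T → ℝ≥0}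
  {P : Measure S} {Q : Measure T} {D c t : ℝ}

lemma lintegral_le_of_mem_couplings {W : Measure (S × T)} (hW : W ∈ couplings ρ P D) :
    0 ≤ D ∧ ∫⁻ z, ρ z ∂W ≤ ENNReal.ofReal D := by
  have h := hW.2.2
  have hD : 0 ≤ D := by
    have : (0 : EReal) ≤ D := (EReal.coe_ennreal_nonneg _).trans h
    exact_mod_cast this
  refine ⟨hD, ?_⟩
  rw [← EReal.coe_ennreal_le_coe_ennreal_iff, EReal.coe_ennreal_ofReal, max_eq_left hD]
  exact h

variable [IsProbabilityMeasure P] [IsProbabilityMeasure Q]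

/-- The relative entropy of a coupling bounds the dual functional. -/
lemma dualBound_of_mem_couplings (hρ : Measurable ρ) {W : Measure (S × T)}
    (hW : W ∈ couplings ρ P D) (hkl : klDiv W (P.prod Q) ≠ ∞) :
    DualBound ρ P Q D (klDiv W (P.prod Q)).toReal := by
  intro t ht
  have := hW.1
  obtain ⟨hD, hWD⟩ := lintegral_le_of_mem_couplings hW
  obtain ⟨hac, hllr⟩ := klDiv_ne_top_iff.1 hkl
  have hgm := measurable_letterCumulant (Q := Q) hρ t
  have hsec : ∀ x, Measurable fun y => ρ (x, y) := fun x => by fun_prop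
  -- Normalised so that exp(b(x,·)) integrates to 1 against Q for every x.
  set b : S × T → ℝ := fun z => letterCumulant ρ Q t z.1 - t * ρ z with hb
  have hbm : Measurable b := (hgm.comp measurable_fst).sub (by fun_prop)
  have hb1 : ∫⁻ z, ENNReal.ofReal (Real.exp (b z)) ∂(P.prod Q) ≤ 1 := by
    rw [lintegral_prod _ (by fun_prop)]
    refine le_of_eq ?_
    have : ∀ x, ∫⁻ y, ENNReal.ofReal (Real.exp (b (x, y))) ∂Q = 1 := by
      intro x
      have h1 : ∀ y, ENNReal.ofReal (Real.exp (b (x, y)))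
          = ENNReal.ofReal (Real.exp (letterCumulant ρ Q t x) * Real.exp (-(t * ρ (x, y)))) := by
        intro y
        rw [← Real.exp_add]
        rfl
      simp_rw [h1]
      rw [← ofReal_integral_eq_lintegral_ofReal
        ((integrable_exp_neg_mul (hsec x) ht).const_mul _)
        (Eventually.of_forall fun y => by positivity), integral_const_mul]
      change ENNReal.ofReal (_ * laplace Q (fun y => ρ (x, y)) t) = 1
      rw [← exp_neg_cumulant (hsec x) ht, ← Real.exp_add]
      simp
    simp [this]
  obtain ⟨v, hv, hv1, hbv⟩ := exists_le_llr_add hac hbm hb1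
  have hρi : Integrable (fun z => (ρ z : ℝ)) W := by
    refine ⟨by fun_prop, ?_⟩
    rw [hasFiniteIntegral_iff_ofReal (Eventually.of_forall fun z => (ρ z).coe_nonneg)]
    simpa using hWD.trans_lt ENNReal.ofReal_lt_top
  have hρD : ∫ z, (ρ z : ℝ) ∂W ≤ D := by
    rw [integral_eq_lintegral_of_nonneg_ae (Eventually.of_forall fun z => (ρ z).coe_nonneg)
      (by fun_prop)]
    exact ENNReal.toReal_le_of_le_ofReal hD (by simpa using hWD)
  have hlv : Integrable (fun z => llr W (P.prod Q) z + v z) W := hllr.add hv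
  have hlv1 : Integrable (fun z => llr W (P.prod Q) z + v z - 1) W :=
    hlv.sub (integrable_const 1)
  have hmaj : Integrable (fun z => t * ρ z + (llr W (P.prod Q) z + v z - 1)) W :=
    (hρi.const_mul t).add hlv1
  have hle : ∀ᵐ z ∂W, letterCumulant ρ Q t z.1 ≤ t * ρ z + (llr W (P.prod Q) z + v z - 1) := by
    filter_upwards [hbv] with z hz
    simp only [hb] at hz
    linarith
  -- The cumulant is nonnegative, so the integrable upper bound alone gives integrability.
  have hgi : Integrable (fun z : S × T => letterCumulant ρ Q t z.1) W := by
    refine hmaj.mono' (hgm.comp measurable_fst).aestronglyMeasurable ?_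
    filter_upwards [hle] with z hz
    rwa [Real.norm_eq_abs, abs_of_nonneg (cumulant_nonneg (hsec _) ht)]
  have hmap : W.map Prod.fst = P := hW.2.1
  refine ⟨?_, ?_⟩
  · rw [← hmap, integrable_map_measure hgm.aestronglyMeasurable (by fun_prop)]
    exact hgi
  · have h1 : ∫ x, letterCumulant ρ Q t x ∂P = ∫ z, letterCumulant ρ Q t z.1 ∂W := by
      conv_lhs => rw [← hmap]
      rw [integral_map (by fun_prop) hgm.aestronglyMeasurable]
    rw [h1, toReal_klDiv_of_measure_eq hac (by simp)]
    refine (integral_mono_ae hgi hmaj hle).trans ?_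
    rw [integral_add (hρi.const_mul t) hlv1,
      integral_const_mul, integral_sub hlv (integrable_const 1), integral_add hllr hv]
    have := mul_le_mul_of_nonneg_left hρD ht
    simp only [integral_const, probReal_univ, smul_eq_mul, mul_one]
    linarith

lemma dualBound_of_rate_lt (hρ : Measurable ρ) (h : rate ρ P Q D < ENNReal.ofReal c) :
    DualBound ρ P Q D c := by
  simp only [rate, iInf_lt_iff] at h
  obtain ⟨W, hW, hlt⟩ := h
  intro t ht
  obtain ⟨h1, h2⟩ := dualBound_of_mem_couplings (Q := Q) hρ hW hlt.ne_top t ht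
  refine ⟨h1, h2.trans ?_⟩
  have := (ENNReal.lt_ofReal_iff_toReal_lt hlt.ne_top).1 hlt
  linarith

/-- The rate is bounded by the relative entropy of the measure with density
`1_E exp (a(x) - t ρ(x, y))`. -/
lemma rate_le_of_density (hρ : Measurable ρ) {E : Set (S × T)} (hE : MeasurableSet E)
    {a b : S → ℝ} (ham : Measurable a) (ha : Integrable a P) (hb0 : ∀ x, 0 ≤ b x)
    (hb : Integrable b P) (hbD : ∫ x, b x ∂P ≤ D)
    (hone : ∀ x, ∫⁻ y, E.indicator
      (fun z => ENNReal.ofReal (Real.exp (a z.1 - t * ρ z))) (x, y) ∂Q = 1)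
    (hmean : ∀ᵐ x ∂P, ∫⁻ y, E.indicator
      (fun z => ENNReal.ofReal (Real.exp (a z.1 - t * ρ z))) (x, y) * ρ (x, y) ∂Q
        = ENNReal.ofReal (b x)) :
    rate ρ P Q D ≤ ENNReal.ofReal (∫ x, a x ∂P - t * ∫ x, b x ∂P) := by
  set F : S × T → ℝ≥0∞ := E.indicator fun z => ENNReal.ofReal (Real.exp (a z.1 - t * ρ z)) with hF
  have hFm : Measurable F := Measurable.indicator (by fun_prop) hE
  set W : Measure (S × T) := (P.prod Q).withDensity F with hWdef
  have hfst : W.fst = P := by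
    ext s hs
    rw [Measure.fst_apply hs, hWdef, withDensity_apply _ (measurable_fst hs),
      ← lintegral_indicator (measurable_fst hs),
      lintegral_prod _ (hFm.indicator (measurable_fst hs)).aemeasurable]
    have : ∀ x, ∫⁻ y, (Prod.fst ⁻¹' s).indicator F (x, y) ∂Q = s.indicator 1 x := by
      intro x
      by_cases hx : x ∈ s
      · simp only [Set.indicator, Set.mem_preimage, hx, if_true]
        exact hone x
      · simp [Set.indicator, hx]
    simp_rw [this]
    rw [lintegral_indicator_one hs]
  have hWprob : IsProbabilityMeasure W :=
    ⟨by rw [← Measure.fst_univ, hfst, measure_univ]⟩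
  have hac : W ≪ P.prod Q := withDensity_absolutelyContinuous _ _
  have hρW : ∫⁻ z, ρ z ∂W = ENNReal.ofReal (∫ x, b x ∂P) := by
    rw [hWdef, lintegral_withDensity_eq_lintegral_mul _ hFm (by fun_prop),
      lintegral_prod _ (by fun_prop), ofReal_integral_eq_lintegral_ofReal hb
        (Eventually.of_forall hb0)]
    exact lintegral_congr_ae hmean
  have hb0' : 0 ≤ ∫ x, b x ∂P := integral_nonneg hb0
  have hρi : Integrable (fun z => (ρ z : ℝ)) W := by
    refine ⟨by fun_prop, ?_⟩
    rw [hasFiniteIntegral_iff_ofReal (Eventually.of_forall fun z => (ρ z).coe_nonneg)]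
    simp only [ENNReal.ofReal_coe_nnreal, hρW]
    exact ENNReal.ofReal_lt_top
  have hρint : ∫ z, (ρ z : ℝ) ∂W = ∫ x, b x ∂P := by
    rw [integral_eq_lintegral_of_nonneg_ae (Eventually.of_forall fun z => (ρ z).coe_nonneg)
      (by fun_prop)]
    simp [hρW, hb0']
  have hmap : W.map Prod.fst = P := hfst
  have hai : Integrable (fun z : S × T => a z.1) W := by
    rw [← hmap, integrable_map_measure ham.aestronglyMeasurable (by fun_prop)] at ha
    exact ha
  have haint : ∫ z, a z.1 ∂W = ∫ x, a x ∂P := by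
    conv_rhs => rw [← hmap]
    rw [integral_map (by fun_prop) ham.aestronglyMeasurable]
  have hllr : llr W (P.prod Q) =ᵐ[W] fun z => a z.1 - t * ρ z := by
    have h1 : ∀ᵐ z ∂W, F z ≠ 0 := (ae_withDensity_iff hFm).2 (Eventually.of_forall fun _ h => h)
    filter_upwards [h1, hac.ae_le (Measure.rnDeriv_withDensity (P.prod Q) hFm)] with z hz1 hz2
    have hzE : z ∈ E := by
      by_contra hcon
      exact hz1 (Set.indicator_of_notMem hcon _)
    rw [llr, hz2, hF, Set.indicator_of_mem hzE, ENNReal.toReal_ofReal (Real.exp_pos _).le,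
      Real.log_exp]
  have hint : Integrable (fun z => a z.1 - t * ρ z) W := hai.sub (hρi.const_mul t)
  have hmem : W ∈ couplings ρ P D := by
    refine ⟨hWprob, hfst, ?_⟩
    rw [hρW, EReal.coe_ennreal_ofReal, max_eq_left hb0']
    exact_mod_cast hbD
  refine (iInf₂_le W hmem).trans (le_of_eq ?_)
  rw [klDiv_of_ac_of_integrable hac ((integrable_congr hllr).2 hint), integral_congr_ae hllr,
    integral_sub hai (hρi.const_mul t), integral_const_mul, hρint, haint]
  simp

/-- The rate is bounded by the relative entropy of the exponentially tilted measure. -/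
lemma rate_le_of_letterMean_le (hρ : Measurable ρ) (ht : 0 < t)
    (hg : Integrable (letterCumulant ρ Q t) P) (hr : Integrable (letterMean ρ Q t) P)
    (hD : ∫ x, letterMean ρ Q t x ∂P ≤ D) :
    rate ρ P Q D ≤ ENNReal.ofReal
      (∫ x, letterCumulant ρ Q t x ∂P - t * ∫ x, letterMean ρ Q t x ∂P) := by
  have hsec : ∀ x, Measurable fun y => ρ (x, y) := fun x => by fun_prop
  have hexp : ∀ x y, Real.exp (letterCumulant ρ Q t x - t * ρ (x, y))
      = (laplace Q (fun y => ρ (x, y)) t)⁻¹ * Real.exp (-(t * ρ (x, y))) := by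
    intro x y
    rw [sub_eq_add_neg, Real.exp_add, ← exp_neg_cumulant (hsec x) ht.le, ← Real.exp_neg, neg_neg]
  have hpos : ∀ x, 0 < laplace Q (fun y => ρ (x, y)) t := fun x => laplace_pos (hsec x) ht.le
  refine rate_le_of_density (E := Set.univ) hρ MeasurableSet.univ (measurable_letterCumulant hρ t)
    hg (fun x => tiltedMean_nonneg) hr hD (fun x => ?_) (Eventually.of_forall fun x => ?_)
  · simp only [Set.indicator_univ, hexp]
    rw [← ofReal_integral_eq_lintegral_ofReal
      ((integrable_exp_neg_mul (hsec x) ht.le).const_mul _)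
      (Eventually.of_forall fun y => mul_nonneg (inv_nonneg.2 (hpos x).le) (Real.exp_pos _).le),
      integral_const_mul]
    change ENNReal.ofReal (_ * laplace Q (fun y => ρ (x, y)) t) = 1
    rw [inv_mul_cancel₀ (hpos x).ne', ENNReal.ofReal_one]
  · simp only [Set.indicator_univ, hexp]
    have h1 : ∀ y, ENNReal.ofReal ((laplace Q (fun y => ρ (x, y)) t)⁻¹
        * Real.exp (-(t * ρ (x, y)))) * ρ (x, y)
        = ENNReal.ofReal ((laplace Q (fun y => ρ (x, y)) t)⁻¹
          * (ρ (x, y) * Real.exp (-(t * ρ (x, y))))) := by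
      intro y
      rw [← ENNReal.ofReal_coe_nnreal, ← ENNReal.ofReal_mul
        (mul_nonneg (inv_nonneg.2 (hpos x).le) (Real.exp_pos _).le)]
      ring_nf
    simp_rw [h1]
    rw [← ofReal_integral_eq_lintegral_ofReal
      ((integrable_mul_exp_neg_mul (hsec x) ht).const_mul _)
      (Eventually.of_forall fun y => mul_nonneg (inv_nonneg.2 (hpos x).le) (by positivity)),
      integral_const_mul, inv_mul_eq_div]
    rfl

/-- The rate is bounded by the relative entropy of the measure concentrated on the minimal
distortion. -/
lemma rate_le_of_letterMin_le (hρ : Measurable ρ)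
    (hm : Integrable (letterMin ρ Q) P) (hD : ∫ x, letterMin ρ Q x ∂P ≤ D)
    (hne : ∀ᵐ x ∂P, Q {y | (ρ (x, y) : ℝ) ≤ letterMin ρ Q x} ≠ 0)
    (hcost : Integrable (letterMinCost ρ Q) P) :
    rate ρ P Q D ≤ ENNReal.ofReal (∫ x, letterMinCost ρ Q x ∂P) := by
  have hsec : ∀ x, Measurable fun y => ρ (x, y) := fun x => by fun_prop
  have hEm := measurableSet_minSet (Q := Q) hρ
  set E := {z : S × T | z.2 ∈ minSet Q fun y => ρ (z.1, y)} with hE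
  have hone : ∀ x, ∫⁻ y, E.indicator
      (fun z => ENNReal.ofReal (Real.exp (letterMinCost ρ Q z.1 - 0 * ρ z))) (x, y) ∂Q = 1 := by
    intro x
    -- The fallback in `minSet` makes this mass positive for every x, so the density is normalised
    -- everywhere; `hne` is needed only to identify the mean distortion.
    have hpos := measure_minSet_pos (Q := Q) (u := fun y => ρ (x, y))
    have hset : MeasurableSet (minSet Q fun y => ρ (x, y)) := measurable_prodMk_left hEm
    have h1 : ∀ y, E.indicator
        (fun z => ENNReal.ofReal (Real.exp (letterMinCost ρ Q z.1 - 0 * ρ z))) (x, y)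
        = (minSet Q fun y => ρ (x, y)).indicator (fun _ => ENNReal.ofReal
          (Q.real (minSet Q fun y => ρ (x, y)))⁻¹) y := by
      intro y
      simp only [Set.indicator, zero_mul, sub_zero, Real.exp_neg, Real.exp_log hpos]
      rfl
    simp_rw [h1]
    rw [lintegral_indicator_const hset, ENNReal.ofReal_inv_of_pos hpos, ofReal_measureReal,
      ENNReal.inv_mul_cancel _ (measure_ne_top _ _)]
    intro h0
    rw [measureReal_def, h0] at hpos
    simp at hpos
  have := rate_le_of_density (t := 0) (Q := Q) (D := D) hρ hEm (measurable_letterMinCost hρ) hcost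
    (fun x => essMin_nonneg (hsec x)) hm hD hone ?_
  · simpa using this
  · filter_upwards [hne] with x hx
    have h1 := ae_essMin_le (Q := Q) (hsec x)
    calc _ = ∫⁻ y, E.indicator
          (fun z => ENNReal.ofReal (Real.exp (letterMinCost ρ Q z.1 - 0 * ρ z))) (x, y)
            * ENNReal.ofReal (letterMin ρ Q x) ∂Q := by
          refine lintegral_congr_ae ?_
          filter_upwards [h1] with y hy
          by_cases hyE : (x, y) ∈ E
          · have hmem : y ∈ minSet Q fun y => ρ (x, y) := hyE
            rw [minSet_of_ne_zero hx] at hmem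
            have : (ρ (x, y) : ℝ) = letterMin ρ Q x := le_antisymm hmem hy
            rw [← this, ENNReal.ofReal_coe_nnreal]
          · simp [Set.indicator_of_notMem hyE]
      _ = _ := by
          rw [lintegral_mul_const' _ _ ENNReal.ofReal_ne_top, hone, one_mul]

/-- Strong duality: a bound on the dual functional bounds the rate. -/
lemma rate_le_of_dualBound (hρ : Measurable ρ) (h : DualBound ρ P Q D c) :
    rate ρ P Q D ≤ ENNReal.ofReal c := by
  by_cases hex : ∃ t, 0 < t ∧ ∫ x, letterMean ρ Q t x ∂P < D
  · obtain ⟨t₀, ht₀, hlt⟩ := hex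
    have hε : ∀ n : ℕ, rate ρ P Q D ≤ ENNReal.ofReal (c + 1 / (n + 1)) := by
      intro n
      obtain ⟨t, ht, htD, hle⟩ := exists_tilt hρ h ht₀ hlt (Nat.one_div_pos_of_nat (n := n))
      exact (rate_le_of_letterMean_le hρ ht (h t ht.le).1 (integrable_letterMean hρ h ht)
        htD.le).trans (ENNReal.ofReal_le_ofReal hle)
    have hlim : Tendsto (fun n : ℕ => ENNReal.ofReal (c + 1 / ((n : ℝ) + 1))) atTop
        (nhds (ENNReal.ofReal (c + 0))) :=
      ENNReal.tendsto_ofReal (tendsto_const_nhds.add tendsto_one_div_add_atTop_nhds_zero_nat)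
    rw [add_zero] at hlim
    exact ge_of_tendsto' hlim hε
  · push Not at hex
    obtain ⟨h1, h2, h3, h4, h5⟩ := integral_letterMin_of_le_letterMean hρ h hex
    exact (rate_le_of_letterMin_le hρ h1 h2.le h3 h4).trans (ENNReal.ofReal_le_ofReal h5)

end Rate

/-! ### Integration against empirical measures -/

section Empirical

variable {S : Type*} [MeasurableSpace S] {n : ℕ} {x : Fin n → S}

lemma isProbabilityMeasure_empiricalMeasure (hn : n ≠ 0) :
    IsProbabilityMeasure (empiricalMeasure x) := by
  refine ⟨?_⟩
  simp only [empiricalMeasure, Measure.smul_apply, Measure.finsetSum_apply, measure_univ,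
    Finset.sum_const, Finset.card_univ, Fintype.card_fin, smul_eq_mul, nsmul_eq_mul, mul_one]
  exact ENNReal.inv_mul_cancel (by simpa using hn) (ENNReal.natCast_ne_top n)

lemma integrable_empiricalMeasure (hn : n ≠ 0) {f : S → ℝ} (hf : Measurable f) :
    Integrable f (empiricalMeasure x) := by
  refine Integrable.smul_measure ?_ (by simpa using hn)
  exact integrable_finsetSum_measure.2 fun k _ => integrable_dirac' hf.stronglyMeasurable (by simp)

lemma integral_empiricalMeasure {f : S → ℝ} (hf : Measurable f) :
    ∫ s, f s ∂(empiricalMeasure x) = (1 / (n : ℝ)) * ∑ k, f (x k) := by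
  rw [empiricalMeasure, integral_smul_measure, integral_finsetSum_measure fun k _ =>
    integrable_dirac' hf.stronglyMeasurable (by simp)]
  simp [integral_dirac' _ _ hf.stronglyMeasurable]

lemma ae_empiricalMeasure {p : S → Prop} (hp : MeasurableSet {s | p s}) (h : ∀ k, p (x k)) :
    ∀ᵐ s ∂(empiricalMeasure x), p s := by
  rw [ae_iff]
  have hc : MeasurableSet {s | ¬ p s} := hp.compl
  simp [empiricalMeasure, Measure.dirac_apply' _ hc, h]

end Empirical

/-! ### Chernoff bounds for distortion balls -/

section Matching

variable {S T : Type*} [MeasurableSpace S] [MeasurableSpace T] {ρ : S × T → ℝ≥0}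
  {Q : Measure T} {D c t : ℝ} {n : ℕ} {x : Fin n → S}

omit [MeasurableSpace S] in
lemma matchingRate_eq (Qn : Measure (Fin n → T)) :
    matchingRate ρ x Qn D
      = -(((1 / (n : ℝ) : ℝ) : EReal) * ENNReal.log (Qn (distortionBall ρ x D))) := by
  rw [matchingRate, EReal.coe_neg, EReal.neg_mul]

lemma coe_one_div_mul_log_exp (hn : n ≠ 0) (c : ℝ) :
    ((1 / (n : ℝ) : ℝ) : EReal) * ENNReal.log (ENNReal.ofReal (Real.exp (-(n * c)))) = -c := by
  have hn' : (n : ℝ) ≠ 0 := Nat.cast_ne_zero.2 hn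
  rw [ENNReal.log_ofReal_of_pos (Real.exp_pos _), Real.log_exp, ← EReal.coe_mul, ← EReal.coe_neg]
  congr 1
  field_simp

omit [MeasurableSpace S] in
lemma le_matchingRate (hn : n ≠ 0) {Qn : Measure (Fin n → T)}
    (h : Qn (distortionBall ρ x D) ≤ ENNReal.ofReal (Real.exp (-(n * c)))) :
    (c : EReal) ≤ matchingRate ρ x Qn D := by
  rw [matchingRate_eq, EReal.le_neg, ← coe_one_div_mul_log_exp hn]
  exact mul_le_mul_of_nonneg_left (ENNReal.log_le_log h) (EReal.coe_nonneg.2 (by positivity))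

omit [MeasurableSpace S] in
lemma matchingRate_le (hn : n ≠ 0) {Qn : Measure (Fin n → T)}
    (h : ENNReal.ofReal (Real.exp (-(n * c))) ≤ Qn (distortionBall ρ x D)) :
    matchingRate ρ x Qn D ≤ c := by
  rw [matchingRate_eq, EReal.neg_le, ← coe_one_div_mul_log_exp hn]
  exact mul_le_mul_of_nonneg_left (ENNReal.log_le_log h) (EReal.coe_nonneg.2 (by positivity))

omit [MeasurableSpace S] [MeasurableSpace T] in
lemma mem_distortionBall_iff (hn : n ≠ 0) (y : Fin n → T) :
    y ∈ distortionBall ρ x D ↔ ∑ k, (ρ (x k, y k) : ℝ) ≤ n * D := by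
  have hn' : (0 : ℝ) < n := Nat.cast_pos.2 (Nat.pos_of_ne_zero hn)
  change 1 / (n : ℝ) * _ ≤ D ↔ _
  rw [one_div, inv_mul_le_iff₀ hn']

variable [IsProbabilityMeasure Q]

lemma integrable_exp_neg_mul_sum (hρ : Measurable ρ) (ht : 0 ≤ t) :
    Integrable (fun y : Fin n → T => Real.exp (-(t * ∑ k, (ρ (x k, y k) : ℝ))))
      (Measure.pi fun _ => Q) := by
  have hm : Measurable fun y : Fin n → T => Real.exp (-(t * ∑ k, (ρ (x k, y k) : ℝ))) := by
    fun_prop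
  refine Integrable.of_bound hm.aestronglyMeasurable 1 (Eventually.of_forall fun y => ?_)
  rw [Real.norm_eq_abs, abs_of_pos (Real.exp_pos _), Real.exp_le_one_iff]
  have : 0 ≤ t * ∑ k, (ρ (x k, y k) : ℝ) := by positivity
  linarith

lemma integral_exp_neg_mul_sum (hρ : Measurable ρ) (ht : 0 ≤ t) :
    ∫ y : Fin n → T, Real.exp (-(t * ∑ k, (ρ (x k, y k) : ℝ))) ∂(Measure.pi fun _ => Q)
      = Real.exp (-∑ k, letterCumulant ρ Q t (x k)) := by
  have h1 : ∀ y : Fin n → T, Real.exp (-(t * ∑ k, (ρ (x k, y k) : ℝ)))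
      = ∏ k, Real.exp (-(t * ρ (x k, y k))) := by
    intro y
    rw [← Real.exp_sum, Finset.sum_neg_distrib, Finset.mul_sum]
  simp_rw [h1]
  rw [integral_fintype_prod_eq_prod (fun k (y : T) => Real.exp (-(t * ρ (x k, y)))),
    ← Finset.sum_neg_distrib, Real.exp_sum]
  refine Finset.prod_congr rfl fun k _ => ?_
  rw [exp_neg_cumulant (by fun_prop) ht]
  rfl

lemma measurableSet_distortionBall (hρ : Measurable ρ) :
    MeasurableSet (distortionBall ρ x D) := by
  refine measurableSet_le ?_ measurable_const
  unfold distortion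
  fun_prop

lemma integrable_indicator_distortionBall (hρ : Measurable ρ) :
    Integrable ((distortionBall ρ x D).indicator (1 : (Fin n → T) → ℝ))
      (Measure.pi fun _ => Q) :=
  (integrable_const (1 : ℝ)).indicator (measurableSet_distortionBall hρ)

/-- The Chernoff bound for the distortion ball. -/
lemma le_matchingRate_of_le (hρ : Measurable ρ) (hn : n ≠ 0) (ht : 0 ≤ t)
    (h : c + t * D ≤ (1 / (n : ℝ)) * ∑ k, letterCumulant ρ Q t (x k)) :
    (c : EReal) ≤ matchingRate ρ x (Measure.pi fun _ => Q) D := by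
  refine le_matchingRate hn ?_
  have hn' : (0 : ℝ) < n := Nat.cast_pos.2 (Nat.pos_of_ne_zero hn)
  have hB := measurableSet_distortionBall (x := x) (D := D) hρ
  have h1 : (Measure.pi fun _ => Q).real (distortionBall ρ x D)
      ≤ Real.exp (t * (n * D)) * Real.exp (-∑ k, letterCumulant ρ Q t (x k)) := by
    rw [← integral_exp_neg_mul_sum hρ ht, ← integral_const_mul, ← integral_indicator_one hB]
    refine integral_mono (integrable_indicator_distortionBall hρ)
      ((integrable_exp_neg_mul_sum hρ ht).const_mul _) fun y => ?_
    by_cases hy : y ∈ distortionBall ρ x D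
    · simp only [Set.indicator_of_mem hy, Pi.one_apply, ← Real.exp_add]
      have := mul_le_mul_of_nonneg_left ((mem_distortionBall_iff hn y).1 hy) ht
      exact Real.one_le_exp (by linarith)
    · simp only [Set.indicator_of_notMem hy]
      positivity
  rw [← ofReal_measureReal]
  refine ENNReal.ofReal_le_ofReal (h1.trans ?_)
  rw [← Real.exp_add, Real.exp_le_exp]
  rw [one_div, ← div_eq_inv_mul, le_div_iff₀ hn'] at h
  linarith

/-- A lower bound on the probability of the distortion ball by exponential tilting, where both
tails of the tilted distribution of the distortion are controlled by the Chernoff bound. -/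
lemma matchingRate_le_of_tilt (hρ : Measurable ρ) (hn : n ≠ 0) {u D₁ δ : ℝ} (hu : 0 ≤ u)
    (hut : u ≤ t) (hδ : 3 * Real.exp (-(n * δ)) ≤ 1)
    (h1 : (1 / (n : ℝ)) * ∑ k, letterCumulant ρ Q t (x k) + δ
      ≤ (1 / (n : ℝ)) * ∑ k, letterCumulant ρ Q (t - u) (x k) + u * D)
    (h2 : (1 / (n : ℝ)) * ∑ k, letterCumulant ρ Q t (x k) + δ
      ≤ (1 / (n : ℝ)) * ∑ k, letterCumulant ρ Q (t + u) (x k) - u * D₁) :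
    matchingRate ρ x (Measure.pi fun _ => Q) D
      ≤ (((1 / (n : ℝ)) * ∑ k, letterCumulant ρ Q t (x k) - t * D₁ + δ : ℝ) : EReal) := by
  have hn' : (0 : ℝ) < n := Nat.cast_pos.2 (Nat.pos_of_ne_zero hn)
  have hsum : ∀ s, ∑ k, letterCumulant ρ Q s (x k)
      = n * ((1 / (n : ℝ)) * ∑ k, letterCumulant ρ Q s (x k)) := by
    intro s
    field_simp
  set a : ℝ := (1 / (n : ℝ)) * ∑ k, letterCumulant ρ Q t (x k) with ha
  set a₁ : ℝ := (1 / (n : ℝ)) * ∑ k, letterCumulant ρ Q (t - u) (x k) with ha₁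
  set a₂ : ℝ := (1 / (n : ℝ)) * ∑ k, letterCumulant ρ Q (t + u) (x k) with ha₂
  have ht : 0 ≤ t := hu.trans hut
  have hB := measurableSet_distortionBall (x := x) (D := D) hρ
  set q := (Measure.pi fun _ : Fin n => Q).real (distortionBall ρ x D) with hq
  have hi0 : Integrable (fun y => Real.exp (-(t * (n * D₁)))
      * (distortionBall ρ x D).indicator (1 : (Fin n → T) → ℝ) y) (Measure.pi fun _ => Q) :=
    (integrable_indicator_distortionBall hρ).const_mul _
  have hi1 : Integrable (fun y : Fin n → T => Real.exp (-(u * (n * D)))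
      * Real.exp (-((t - u) * ∑ k, (ρ (x k, y k) : ℝ)))) (Measure.pi fun _ => Q) :=
    (integrable_exp_neg_mul_sum hρ (by linarith)).const_mul _
  have hi2 : Integrable (fun y : Fin n → T => Real.exp (u * (n * D₁))
      * Real.exp (-((t + u) * ∑ k, (ρ (x k, y k) : ℝ)))) (Measure.pi fun _ => Q) :=
    (integrable_exp_neg_mul_sum hρ (by linarith)).const_mul _
  have hi01 : Integrable (fun y => Real.exp (-(t * (n * D₁)))
      * (distortionBall ρ x D).indicator (1 : (Fin n → T) → ℝ) y + Real.exp (-(u * (n * D)))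
      * Real.exp (-((t - u) * ∑ k, (ρ (x k, y k) : ℝ)))) (Measure.pi fun _ => Q) := hi0.add hi1
  -- Pointwise in the total distortion s: the three terms dominate exp(-ts) on the ball with s ≥
  -- nD₁, off the ball, and for s ≤ nD₁ respectively.
  have key : Real.exp (-(n * a)) ≤ Real.exp (-(t * (n * D₁))) * q
      + Real.exp (-(u * (n * D))) * Real.exp (-(n * a₁))
      + Real.exp (u * (n * D₁)) * Real.exp (-(n * a₂)) := by
    rw [ha, ha₁, ha₂, ← hsum, ← hsum, ← hsum, ← integral_exp_neg_mul_sum hρ ht,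
      ← integral_exp_neg_mul_sum hρ (by linarith), ← integral_exp_neg_mul_sum hρ (by linarith),
      hq, ← integral_indicator_one hB, ← integral_const_mul, ← integral_const_mul,
      ← integral_const_mul, ← integral_add hi0 hi1, ← integral_add hi01 hi2]
    refine integral_mono (integrable_exp_neg_mul_sum hρ ht) (hi01.add hi2) fun y => ?_
    simp only [← Real.exp_add]
    set s := ∑ k, (ρ (x k, y k) : ℝ) with hs
    have hind : 0 ≤ (distortionBall ρ x D).indicator (1 : (Fin n → T) → ℝ) y :=
      Set.indicator_nonneg (fun _ _ => zero_le_one) _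
    have hp0 := mul_nonneg (Real.exp_pos (-(t * (n * D₁)))).le hind
    have hp1 := Real.exp_pos (-(u * (n * D)) + -((t - u) * s))
    have hp2 := Real.exp_pos (u * (n * D₁) + -((t + u) * s))
    rcases le_total s (n * D₁) with hc | hc
    · have : Real.exp (-(t * s)) ≤ Real.exp (u * (n * D₁) + -((t + u) * s)) :=
        Real.exp_le_exp.2 (by nlinarith [mul_le_mul_of_nonneg_left hc hu])
      linarith
    · by_cases hy : y ∈ distortionBall ρ x D
      · rw [Set.indicator_of_mem hy, Pi.one_apply, mul_one]
        have : Real.exp (-(t * s)) ≤ Real.exp (-(t * (n * D₁))) :=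
          Real.exp_le_exp.2 (by nlinarith [mul_le_mul_of_nonneg_left hc ht])
        linarith
      · have hc' : n * D ≤ s := (not_le.1 (mt (mem_distortionBall_iff hn y).2 hy)).le
        have : Real.exp (-(t * s)) ≤ Real.exp (-(u * (n * D)) + -((t - u) * s)) :=
          Real.exp_le_exp.2 (by nlinarith [mul_le_mul_of_nonneg_left hc' hu])
        linarith
  have hb1 : Real.exp (-(u * (n * D))) * Real.exp (-(n * a₁))
      ≤ Real.exp (-(n * a)) * Real.exp (-(n * δ)) := by
    rw [← Real.exp_add, ← Real.exp_add, Real.exp_le_exp]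
    nlinarith
  have hb2 : Real.exp (u * (n * D₁)) * Real.exp (-(n * a₂))
      ≤ Real.exp (-(n * a)) * Real.exp (-(n * δ)) := by
    rw [← Real.exp_add, ← Real.exp_add, Real.exp_le_exp]
    nlinarith
  refine matchingRate_le hn ?_
  rw [← ofReal_measureReal, ← hq]
  refine ENNReal.ofReal_le_ofReal ?_
  -- Each tail carries at most a fraction exp(-nδ) of the total; by `hδ` the ball keeps at least 1 -
  -- 2 exp(-nδ) ≥ exp(-nδ).
  have hb3 : Real.exp (-(n * a)) * Real.exp (-(n * δ)) ≤ Real.exp (-(t * (n * D₁))) * q := by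
    nlinarith [Real.exp_pos (-(n * a))]
  have hmul := mul_le_mul_of_nonneg_left hb3 (Real.exp_pos (t * (n * D₁))).le
  rw [← mul_assoc, ← mul_assoc _ _ q, ← Real.exp_add, ← Real.exp_add, ← Real.exp_add,
    add_neg_cancel, Real.exp_zero, one_mul] at hmul
  refine le_trans (le_of_eq ?_) hmul
  congr 1
  ring

omit [MeasurableSpace S] in
/-- A lower bound on the probability of the distortion ball by the product of the sets of minimal
distortion. -/
lemma matchingRate_le_of_letterMin (hn : n ≠ 0)
    (hne : ∀ k, Q {y | (ρ (x k, y) : ℝ) ≤ letterMin ρ Q (x k)} ≠ 0)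
    (hm : ∑ k, letterMin ρ Q (x k) ≤ n * D) :
    matchingRate ρ x (Measure.pi fun _ => Q) D
      ≤ (((1 / (n : ℝ)) * ∑ k, letterMinCost ρ Q (x k) : ℝ) : EReal) := by
  have hn' : (n : ℝ) ≠ 0 := Nat.cast_ne_zero.2 hn
  refine matchingRate_le hn ?_
  have hsub : Set.univ.pi (fun k => minSet Q fun y => ρ (x k, y)) ⊆ distortionBall ρ x D := by
    intro y hy
    rw [mem_distortionBall_iff hn]
    refine (Finset.sum_le_sum fun k _ => ?_).trans hm
    have : y k ∈ minSet Q fun y => ρ (x k, y) := hy k trivial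
    rwa [minSet_of_ne_zero (hne k)] at this
  refine le_trans (le_of_eq ?_) (measure_mono hsub)
  rw [Measure.pi_pi, ← mul_assoc, mul_one_div_cancel hn', one_mul, ← Finset.sum_neg_distrib,
    Real.exp_sum, ENNReal.ofReal_prod_of_nonneg fun k _ => (Real.exp_pos _).le]
  refine Finset.prod_congr rfl fun k _ => ?_
  rw [letterMinCost, neg_neg, Real.exp_log measure_minSet_pos, ofReal_measureReal]

end Matching

/-! ### Almost sure bounds along an ergodic sequence -/

section Shift

variable {S T : Type*} [MeasurableSpace S] [MeasurableSpace T] {ρ : S × T → ℝ≥0}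
  {Q : Measure T} {D c : ℝ} {ν : Measure (ℕ → S)} {f : S → ℝ}

omit [MeasurableSpace S] in
lemma iterate_shift (k : ℕ) : ∀ (x : ℕ → S) (j : ℕ),
    (fun (x : ℕ → S) (i : ℕ) => x (i + 1))^[k] x j = x (j + k) := by
  induction k with
  | zero => exact fun x j => rfl
  | succ k ih =>
    intro x j
    rw [Function.iterate_succ_apply, ih, add_assoc, add_comm k 1]

omit [MeasurableSpace S] in
lemma birkhoffSum_shift (f : S → ℝ) (n : ℕ) (x : ℕ → S) :
    birkhoffSum (fun (x : ℕ → S) (i : ℕ) => x (i + 1)) (fun x => f (x 0)) n x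
      = ∑ k : Fin n, f (x k) := by
  rw [birkhoffSum, Finset.sum_range]
  simp [iterate_shift]

lemma integral_map_zero (hf : Measurable f) :
    ∫ s, f s ∂(ν.map fun x => x 0) = ∫ x, f (x 0) ∂ν :=
  integral_map (measurable_pi_apply 0).aemeasurable hf.aestronglyMeasurable

lemma integrable_map_zero (hf : Measurable f) :
    Integrable f (ν.map fun x => x 0) ↔ Integrable (fun x => f (x 0)) ν :=
  integrable_map_measure hf.aestronglyMeasurable (measurable_pi_apply 0).aemeasurable

variable [IsProbabilityMeasure ν]

lemma ae_tendsto_average (hν : Ergodic (fun (x : ℕ → S) (i : ℕ) => x (i + 1)) ν)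
    (hf : Measurable f) (hfi : Integrable f (ν.map fun x => x 0)) :
    ∀ᵐ x ∂ν, Tendsto (fun n : ℕ => (1 / (n : ℝ)) * ∑ k : Fin n, f (x k)) atTop
      (nhds (∫ s, f s ∂(ν.map fun x => x 0))) := by
  rw [integral_map_zero hf]
  rw [integrable_map_zero hf] at hfi
  simpa only [birkhoffSum_shift] using
    ae_tendsto_birkhoffSum (f := fun x : ℕ → S => f (x 0)) hν (hf.comp (measurable_pi_apply 0)) hfi

lemma ae_eventually_lt_average (hν : Ergodic (fun (x : ℕ → S) (i : ℕ) => x (i + 1)) ν)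
    (hf : Measurable f) (hf0 : ∀ s, 0 ≤ f s) {a : ℝ}
    (ha : ¬ (Integrable f (ν.map fun x => x 0) ∧ ∫ s, f s ∂(ν.map fun x => x 0) ≤ a)) :
    ∀ᵐ x ∂ν, ∀ᶠ n : ℕ in atTop, a < (1 / (n : ℝ)) * ∑ k : Fin n, f (x k) := by
  rw [integral_map_zero hf, integrable_map_zero hf] at ha
  simpa only [birkhoffSum_shift] using
    ae_eventually_lt_birkhoffSum (f := fun x : ℕ → S => f (x 0)) hν (hf.comp (measurable_pi_apply 0)) (fun x => hf0 (x 0)) ha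

lemma ae_frequently_sum_le (hν : Ergodic (fun (x : ℕ → S) (i : ℕ) => x (i + 1)) ν)
    (hf : Measurable f) (hfi : Integrable f (ν.map fun x => x 0)) :
    ∀ᵐ x ∂ν, ∃ᶠ n : ℕ in atTop,
      ∑ k : Fin n, f (x k) ≤ n * ∫ s, f s ∂(ν.map fun x => x 0) := by
  set m := ∫ s, f s ∂(ν.map fun x => x 0) with hm
  rw [integral_map_zero hf] at hm
  rw [integrable_map_zero hf] at hfi
  have h := ae_frequently_birkhoffSum_nonpos (f := fun x : ℕ → S => f (x 0) - m) hν
    ((hf.comp (measurable_pi_apply 0)).sub_const m) (hfi.sub (integrable_const m)) (by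
      rw [integral_sub hfi (integrable_const m), ← hm]
      simp)
  filter_upwards [h] with x hx
  refine hx.mono fun n hn => ?_
  rw [birkhoffSum_shift (fun s => f s - m)] at hn
  simp only [Finset.sum_sub_distrib, Finset.sum_const, Finset.card_univ, Fintype.card_fin,
    nsmul_eq_mul] at hn
  linarith

omit [IsProbabilityMeasure ν] in
lemma ae_forall_letter (hν : Ergodic (fun (x : ℕ → S) (i : ℕ) => x (i + 1)) ν) {p : S → Prop}
    (hp : ∀ᵐ s ∂(ν.map fun x => x 0), p s) : ∀ᵐ x ∂ν, ∀ k, p (x k) := by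
  have h0 : ∀ᵐ x ∂ν, p (x 0) := ae_of_ae_map (measurable_pi_apply 0).aemeasurable hp
  refine ae_all_iff.2 fun k => ?_
  filter_upwards [(hν.toMeasurePreserving.iterate k).quasiMeasurePreserving.ae h0] with x hx
  simpa [iterate_shift] using hx

variable [IsProbabilityMeasure Q]

/-- Where the dual functional exceeds `c`, both rates eventually exceed `c`. -/
lemma ae_eventually_ge_of_not_dualBound
    (hν : Ergodic (fun (x : ℕ → S) (i : ℕ) => x (i + 1)) ν) (hρ : Measurable ρ)
    (h : ¬ DualBound ρ (ν.map fun x => x 0) Q D c) :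
    ∀ᵐ x ∂ν, ∀ᶠ n : ℕ in atTop,
      (c : EReal) ≤ matchingRate ρ (fun k : Fin n => x k) (Measure.pi fun _ => Q) D ∧
      ENNReal.ofReal c ≤ rate ρ (empiricalMeasure fun k : Fin n => x k) Q D := by
  unfold DualBound at h
  push Not at h
  obtain ⟨t, ht, hnot⟩ := h
  have hgm := measurable_letterCumulant (Q := Q) hρ t
  -- Failure of the dual bound may mean a cumulant that is not integrable; the ergodic lower bound
  -- for nonnegative functions covers both cases.
  filter_upwards [ae_eventually_lt_average hν hgm (fun s => cumulant_nonneg (by fun_prop) ht)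
    (a := c + t * D) fun hcon => absurd hcon.2 (not_le.2 (hnot hcon.1))] with x hx
  filter_upwards [hx, eventually_ne_atTop 0] with n hn hn0
  refine ⟨le_matchingRate_of_le hρ hn0 ht hn.le, ?_⟩
  by_contra hcon
  have := isProbabilityMeasure_empiricalMeasure (x := fun k : Fin n => x k) hn0
  have h1 := (dualBound_of_rate_lt hρ (not_le.1 hcon) t ht).2
  rw [integral_empiricalMeasure hgm] at h1
  exact absurd h1 (not_le.2 hn)

/-- With D₁ < mean < D at the tilt t, the tilted law concentrates on distortions between nD₁ and nD.
The tangents at t ± u make both Chernoff exponents strictly positive, and the ergodic theorem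
carries these strict inequalities over to the sample. For the empirical rate the same t is used
directly as a tilt. -/
lemma ae_eventually_le_of_tilt
    (hν : Ergodic (fun (x : ℕ → S) (i : ℕ) => x (i + 1)) ν) (hρ : Measurable ρ)
    (h : DualBound ρ (ν.map fun x => x 0) Q D c) {t ε : ℝ} (ht : 0 < t) (hε : 0 < ε)
    (hD : ∫ s, letterMean ρ Q t s ∂(ν.map fun x => x 0) < D)
    (hc : ∫ s, letterCumulant ρ Q t s ∂(ν.map fun x => x 0)
      - t * ∫ s, letterMean ρ Q t s ∂(ν.map fun x => x 0) ≤ c) :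
    ∀ᵐ x ∂ν, ∀ᶠ n : ℕ in atTop,
      matchingRate ρ (fun k : Fin n => x k) (Measure.pi fun _ => Q) D ≤ ((c + ε : ℝ) : EReal) ∧
      rate ρ (empiricalMeasure fun k : Fin n => x k) Q D ≤ ENNReal.ofReal (c + ε) := by
  set P := ν.map fun x => x 0 with hP
  set G : ℝ → ℝ := fun t => ∫ s, letterCumulant ρ Q t s ∂P with hG
  set R : ℝ → ℝ := fun t => ∫ s, letterMean ρ Q t s ∂P with hR
  -- Replacing the mean by `D₁` costs t(R t - D₁) = ε/4. Another ε/4 is spent on δ and ε/2 on the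
  -- sample average.
  set D₁ := R t - ε / (4 * t) with hD₁
  have htD₁ : t * D₁ = t * R t - ε / 4 := by
    rw [hD₁, mul_sub]
    congr 1
    field_simp
  have hD₁R : D₁ < R t := by
    rw [hD₁]
    linarith [div_pos hε (by linarith : 0 < 4 * t)]
  have hcont : ContinuousAt R t := continuousAt_integral_letterMean hρ h ht
  have hsub : Tendsto (fun u => R (t - u)) (nhdsWithin 0 (Set.Ioi 0)) (nhds (R t)) := by
    refine hcont.tendsto.comp ?_
    have : Tendsto (fun u => t - u) (nhds 0) (nhds (t - 0)) := by
      apply Continuous.tendsto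
      fun_prop
    rw [sub_zero] at this
    exact this.mono_left nhdsWithin_le_nhds
  have hadd : Tendsto (fun u => R (t + u)) (nhdsWithin 0 (Set.Ioi 0)) (nhds (R t)) := by
    refine hcont.tendsto.comp ?_
    have : Tendsto (fun u => t + u) (nhds 0) (nhds (t + 0)) := by
      apply Continuous.tendsto
      fun_prop
    rw [add_zero] at this
    exact this.mono_left nhdsWithin_le_nhds
  have hut_ev : ∀ᶠ u in nhdsWithin (0 : ℝ) (Set.Ioi 0), u < t :=
    nhdsWithin_le_nhds (gt_mem_nhds ht)
  obtain ⟨u, ⟨⟨hu1, hu2⟩, hut⟩, hu0⟩ := ((((hsub.eventually (gt_mem_nhds hD)).and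
    (hadd.eventually (lt_mem_nhds hD₁R))).and hut_ev).and self_mem_nhdsWithin).exists
  have hu0 : 0 < u := hu0
  have hgap1 : G t < G (t - u) + u * D := by
    have := integral_letterCumulant_le hρ h (sub_pos.2 hut) ht.le
    have h2 := mul_lt_mul_of_pos_left hu1 hu0
    rw [sub_sub_cancel] at this
    simp only [hG, hR] at *
    linarith
  have hgap2 : G t < G (t + u) - u * D₁ := by
    have := integral_letterCumulant_le hρ h (add_pos ht hu0) ht.le
    have h2 := mul_lt_mul_of_pos_left hu2 hu0
    rw [sub_add_cancel_left] at this
    simp only [hG, hR] at *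
    linarith
  obtain ⟨δ, hδ0, hδ⟩ := exists_between (a₁ := 0)
    (a₂ := min (min (G (t - u) + u * D - G t) (G (t + u) - u * D₁ - G t)) (ε / 4))
    (lt_min (lt_min (by linarith) (by linarith)) (by linarith))
  rw [lt_min_iff, lt_min_iff] at hδ
  have hexp : ∀ᶠ n : ℕ in atTop, 3 * Real.exp (-((n : ℝ) * δ)) ≤ 1 := by
    have h1 : Tendsto (fun n : ℕ => 3 * Real.exp (-((n : ℝ) * δ))) atTop (nhds (3 * 0)) :=
      (Real.tendsto_exp_neg_atTop_nhds_zero.comp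
        (tendsto_natCast_atTop_atTop.atTop_mul_const hδ0)).const_mul 3
    rw [mul_zero] at h1
    exact h1.eventually (ge_mem_nhds zero_lt_one)
  have hlim : ∀ s, 0 ≤ s → ∀ᵐ x ∂ν, Tendsto (fun n : ℕ => (1 / (n : ℝ)) *
      ∑ k : Fin n, letterCumulant ρ Q s (x k)) atTop (nhds (G s)) := fun s hs =>
    ae_tendsto_average hν (measurable_letterCumulant hρ s) (h s hs).1
  have hlimr : ∀ᵐ x ∂ν, Tendsto (fun n : ℕ => (1 / (n : ℝ)) *
      ∑ k : Fin n, letterMean ρ Q t (x k)) atTop (nhds (R t)) :=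
    ae_tendsto_average hν (measurable_letterMean hρ t) (integrable_letterMean hρ h ht)
  filter_upwards [hlim t ht.le, hlim (t - u) (by linarith), hlim (t + u) (by linarith), hlimr]
    with x hx hx1 hx2 hxr
  have e1 := (hx.add_const δ).eventually_lt (hx1.add_const (u * D)) (by linarith [hδ.1.1])
  have e2 := (hx.add_const δ).eventually_lt (hx2.sub_const (u * D₁)) (by linarith [hδ.1.2])
  have e3 := hx.eventually_lt_const (show G t < c + ε / 2 + t * R t by simp only [hG, hR]; linarith)
  have e4 := (hx.sub (hxr.const_mul t)).eventually_lt_const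
    (show G t - t * R t < c + ε by simp only [hG, hR]; linarith)
  have e5 := hxr.eventually_lt_const hD
  filter_upwards [e1, e2, e3, e4, e5, hexp, eventually_ne_atTop 0] with n h1 h2 h3 h4 h5 h6 hn0
  have hprob := isProbabilityMeasure_empiricalMeasure (x := fun k : Fin n => x k) hn0
  constructor
  · refine (matchingRate_le_of_tilt hρ hn0 hu0.le hut.le h6 h1.le h2.le).trans ?_
    rw [EReal.coe_le_coe_iff]
    linarith [hδ.2]
  · have := rate_le_of_letterMean_le (P := empiricalMeasure fun k : Fin n => x k) hρ ht
      (integrable_empiricalMeasure hn0 (measurable_letterCumulant (Q := Q) hρ t))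
      (integrable_empiricalMeasure hn0 (measurable_letterMean (Q := Q) hρ t))
      (D := D) (by rw [integral_empiricalMeasure (measurable_letterMean hρ t)]; exact h5.le)
    refine this.trans (ENNReal.ofReal_le_ofReal ?_)
    rw [integral_empiricalMeasure (measurable_letterMean hρ t),
      integral_empiricalMeasure (measurable_letterCumulant hρ t)]
    exact h4.le

/-- Where `c` bounds the dual functional, both rates are infinitely often at most `c + ε`. -/
lemma ae_frequently_le_of_dualBound
    (hν : Ergodic (fun (x : ℕ → S) (i : ℕ) => x (i + 1)) ν) (hρ : Measurable ρ)
    (h : DualBound ρ (ν.map fun x => x 0) Q D c) {ε : ℝ} (hε : 0 < ε) :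
    ∀ᵐ x ∂ν, ∃ᶠ n : ℕ in atTop,
      matchingRate ρ (fun k : Fin n => x k) (Measure.pi fun _ => Q) D ≤ ((c + ε : ℝ) : EReal) ∧
      rate ρ (empiricalMeasure fun k : Fin n => x k) Q D ≤ ENNReal.ofReal (c + ε) := by
  have hprobP : IsProbabilityMeasure (ν.map fun x => x 0) :=
    Measure.isProbabilityMeasure_map (measurable_pi_apply 0).aemeasurable
  by_cases hex : ∃ t, 0 < t ∧ ∫ s, letterMean ρ Q t s ∂(ν.map fun x => x 0) < D
  · obtain ⟨t₀, ht₀, hlt⟩ := hex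
    obtain ⟨t, ht, htD, hle⟩ := exists_tilt hρ h ht₀ hlt (half_pos hε)
    have h' : DualBound ρ (ν.map fun x => x 0) Q D (c + ε / 2) := fun t ht =>
      ⟨(h t ht).1, (h t ht).2.trans (by linarith)⟩
    filter_upwards [ae_eventually_le_of_tilt hν hρ h' ht (half_pos hε) htD hle] with x hx
    rw [add_assoc, add_halves] at hx
    exact hx.frequently
  · push Not at hex
    obtain ⟨hmi, hmD, hne, hci, hcc⟩ := integral_letterMin_of_le_letterMean hρ h hex
    have hgood : MeasurableSet {s | Q {y | (ρ (s, y) : ℝ) ≤ letterMin ρ Q s} ≠ 0} := by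
      have h1 : MeasurableSet {z : S × T | (ρ z : ℝ) ≤ letterMin ρ Q z.1} :=
        measurableSet_le (by fun_prop) ((measurable_letterMin hρ).comp measurable_fst)
      exact measurable_measure_prodMk_left h1 (measurableSet_singleton 0).compl
    -- Boundary case: the sums of the minima, whose mean is D, are at most nD infinitely often. At
    -- those n the product of minimal sets lies in the ball, and concentrating on them is admissible
    -- for the empirical measure.
    filter_upwards [ae_frequently_sum_le hν (measurable_letterMin hρ) hmi,
      ae_tendsto_average hν (measurable_letterMinCost hρ) hci, ae_forall_letter hν hne]
      with x hx1 hx2 hx3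
    rw [hmD] at hx1
    have e1 := hx2.eventually_lt_const (hcc.trans_lt (lt_add_of_pos_right c hε))
    refine (hx1.and_eventually (e1.and (eventually_ne_atTop 0))).mono ?_
    rintro n ⟨hsum, hlt, hn0⟩
    have hprob := isProbabilityMeasure_empiricalMeasure (x := fun k : Fin n => x k) hn0
    have hn' : (0 : ℝ) < n := Nat.cast_pos.2 (Nat.pos_of_ne_zero hn0)
    constructor
    · refine (matchingRate_le_of_letterMin hn0 (fun k => hx3 k) hsum).trans ?_
      rw [EReal.coe_le_coe_iff]
      exact hlt.le
    · refine (rate_le_of_letterMin_le (P := empiricalMeasure fun k : Fin n => x k) hρ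
        (integrable_empiricalMeasure hn0 (measurable_letterMin hρ)) ?_
        (ae_empiricalMeasure hgood fun k => hx3 k)
        (integrable_empiricalMeasure hn0 (measurable_letterMinCost hρ))).trans
        (ENNReal.ofReal_le_ofReal ?_)
      · rw [integral_empiricalMeasure (measurable_letterMin hρ), one_div, inv_mul_le_iff₀ hn']
        exact hsum
      · rw [integral_empiricalMeasure (measurable_letterMinCost hρ)]
        exact hlt.le

end Shift

/-! ### From thresholds to lower limits -/

lemma DualBound.nonneg {S T : Type*} [MeasurableSpace S] [MeasurableSpace T] {ρ : S × T → ℝ≥0}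
    {P : Measure S} {Q : Measure T} [IsProbabilityMeasure Q] {D c : ℝ}
    (h : DualBound ρ P Q D c) : 0 ≤ c := by
  have := (h 0 le_rfl).2
  simpa [letterCumulant, cumulant_zero] using this

/-- A sequence whose lower limit is squeezed by a threshold property of the rationals. -/
lemma liminf_eq_of_rat {u : ℕ → EReal} {R : EReal} {C : ℝ → Prop}
    (h1 : ∀ q : ℚ, R < ((q : ℝ) : EReal) → C q) (h2 : ∀ q : ℚ, C q → R ≤ ((q : ℝ) : EReal))
    (hlow : ∀ q : ℚ, ¬ C q → ∀ᶠ n in atTop, ((q : ℝ) : EReal) ≤ u n)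
    (hup : ∀ q q' : ℚ, C q → q < q' → ∃ᶠ n in atTop, u n ≤ ((q' : ℝ) : EReal)) :
    liminf u atTop = R := by
  refine le_antisymm ?_ ?_
  · by_contra hcon
    obtain ⟨q, hq1, hq2⟩ := EReal.lt_iff_exists_rat_btwn.1 (not_le.1 hcon)
    obtain ⟨q', hq1', hq2'⟩ := EReal.lt_iff_exists_rat_btwn.1 hq2
    have hqq : q < q' := by exact_mod_cast hq1'
    exact absurd (liminf_le_of_frequently_le' (hup q q' (h1 q hq1) hqq)) (not_le.2 hq2')
  · by_contra hcon
    obtain ⟨q, hq1, hq2⟩ := EReal.lt_iff_exists_rat_btwn.1 (not_le.1 hcon)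
    have hC : ¬ C q := fun hC => absurd (h2 q hC) (not_le.2 hq2)
    exact absurd (le_liminf_of_le (h := hlow q hC)) (not_le.2 hq1)

lemma coe_ennreal_liminf (u : ℕ → ℝ≥0∞) :
    ((liminf u atTop : ℝ≥0∞) : EReal) = liminf (fun n => (u n : EReal)) atTop :=
  Monotone.map_liminf_of_continuousAt EReal.coe_ennreal_strictMono.monotone u
    continuous_coe_ennreal_ereal.continuousAt

end GenAEP

theorem theorem1 {S T Ω : Type*}
    [MeasurableSpace S] [StandardBorelSpace S] [MeasurableSpace T] [StandardBorelSpace T]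
    [MeasurableSpace Ω] (μ : Measure Ω) [IsProbabilityMeasure μ]
    (ρ : S × T → ℝ≥0) (hρ : Measurable ρ)
    (P : Measure S) (Q : Measure T) [IsProbabilityMeasure Q]
    (X : ℕ → Ω → S) (hX : GenAEP.IsStationaryErgodic X μ) (hP : μ.map (X 0) = P) (D : ℝ) :
    (∀ᵐ ω ∂μ, liminf (fun n : ℕ => GenAEP.matchingRate ρ (fun k : Fin n => X k ω)
        (Measure.pi fun _ : Fin n => Q) D) atTop = (GenAEP.rate ρ P Q D : EReal)) ∧
    (∀ᵐ ω ∂μ, liminf (fun n : ℕ =>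
        GenAEP.rate ρ (GenAEP.empiricalMeasure fun k : Fin n => X k ω) Q D) atTop
      = GenAEP.rate ρ P Q D) := by
  obtain ⟨hXm, hν⟩ := hX
  have hXm' : Measurable fun ω k => X k ω := measurable_pi_lambda _ hXm
  set ν : Measure (ℕ → S) := μ.map fun ω k => X k ω with hνdef
  have hνprob : IsProbabilityMeasure ν := Measure.isProbabilityMeasure_map hXm'.aemeasurable
  have hνP : (ν.map fun x => x 0) = P := by
    rw [hνdef, Measure.map_map (measurable_pi_apply 0) hXm', ← hP]
    rfl
  have hPprob : IsProbabilityMeasure P := by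
    rw [← hP]
    exact Measure.isProbabilityMeasure_map (hXm 0).aemeasurable
  have h1 : ∀ q : ℚ, (GenAEP.rate ρ P Q D : EReal) < ((q : ℝ) : EReal) →
      GenAEP.DualBound ρ P Q D q := by
    intro q hq
    refine GenAEP.dualBound_of_rate_lt hρ ?_
    rw [← EReal.coe_ennreal_lt_coe_ennreal_iff, EReal.coe_ennreal_ofReal]
    exact hq.trans_le (EReal.coe_le_coe_iff.2 (le_max_left _ _))
  have h2 : ∀ q : ℚ, GenAEP.DualBound ρ P Q D q →
      (GenAEP.rate ρ P Q D : EReal) ≤ ((q : ℝ) : EReal) := by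
    intro q hq
    have := EReal.coe_ennreal_le_coe_ennreal_iff.2 (GenAEP.rate_le_of_dualBound hρ hq)
    rwa [EReal.coe_ennreal_ofReal, max_eq_left hq.nonneg] at this
  -- Restricting the thresholds to rationals leaves a countable union of null sets.
  have hlow := ae_all_iff.2 fun q : ℚ => Filter.eventually_imp_distrib_left.2 fun
    (hq : ¬ GenAEP.DualBound ρ (ν.map fun x => x 0) Q D q) =>
      GenAEP.ae_eventually_ge_of_not_dualBound hν hρ hq
  have hup := ae_all_iff.2 fun q : ℚ => ae_all_iff.2 fun q' : ℚ =>
    Filter.eventually_imp_distrib_left.2 fun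
      (hq : GenAEP.DualBound ρ (ν.map fun x => x 0) Q D q ∧ q < q') =>
        GenAEP.ae_frequently_le_of_dualBound hν hρ hq.1
          (sub_pos.2 (Rat.cast_lt (K := ℝ).2 hq.2))
  simp only [hνP, add_sub_cancel] at hlow hup
  have hlow' := ae_of_ae_map hXm'.aemeasurable hlow
  have hup' := ae_of_ae_map hXm'.aemeasurable hup
  constructor
  · filter_upwards [hlow', hup'] with ω hω1 hω2
    exact GenAEP.liminf_eq_of_rat h1 h2 (fun q hq => (hω1 q hq).mono fun n hn => hn.1)
      (fun q q' hq hqq => (hω2 q q' ⟨hq, hqq⟩).mono fun n hn => hn.1)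
  · filter_upwards [hlow', hup'] with ω hω1 hω2
    rw [← EReal.coe_ennreal_eq_coe_ennreal_iff, GenAEP.coe_ennreal_liminf]
    refine GenAEP.liminf_eq_of_rat h1 h2 (fun q hq => (hω1 q hq).mono fun n hn => ?_)
      (fun q q' hq hqq => (hω2 q q' ⟨hq, hqq⟩).mono fun n hn => ?_)
    · refine le_trans ?_ (EReal.coe_ennreal_le_coe_ennreal_iff.2 hn.2)
      rw [EReal.coe_ennreal_ofReal]
      exact EReal.coe_le_coe_iff.2 (le_max_left _ _)
    · refine (EReal.coe_ennreal_le_coe_ennreal_iff.2 hn.2).trans (le_of_eq ?_)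
      rw [EReal.coe_ennreal_ofReal, max_eq_left]
      exact hq.nonneg.trans (Rat.cast_le.2 hqq.le)
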